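/- **Language.** Fix a set $\mathcal A$ of atomic types and an infinite set of term variables. Types are $A,B ::= X \mid I \mid \mathbf A \mid A+B \mid A\otimes B \mid \mu X.A$ (with $\mathbf A\in\mathcal A$, up to renaming of bound type variables; nested $\mu$ is allowed), and $\mathbf{bit}:=I+I$. Variable contexts $\Gamma=x_1:A_1,\dots,x_n:A_n$ consist of distinct variables of closed types; their order is irrelevant (reordering is interpreted by symmetries). Term judgements $\vdash\langle\Gamma\rangle\,M\,\langle\Sigma\rangle$ are generated by the following rules, in which a variable that is added to a context must not already occur in it: - $\langle\Gamma\rangle\ \mathbf{new\ unit}\ u\ \langle\Gamma,u:I\rangle$; $\ \langle\Gamma,x:A\rangle\ \mathbf{discard}\ x\ \langle\Gamma\rangle$; $\ \langle\Gamma\rangle\ \mathbf{skip}\ \langle\Gamma\rangle$; - if $\langle\Gamma\rangle M\langle\Gamma'\rangle$ and $\langle\Gamma'\rangle N\langle\Sigma\rangle$ then $\langle\Gamma\rangle\, M;N\,\langle\Sigma\rangle$; - if $\langle\Gamma,b:\mathbf{bit}\rangle M\langle\Gamma,b:\mathbf{bit}\rangle$ then $\langle\Gamma,b:\mathbf{bit}\rangle\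 \mathbf{while}\ b\ \mathbf{do}\ M\ \langle\Gamma,b:\mathbf{bit}\rangle$; - $\langle\Gamma,x:A\rangle\ y=\mathbf{left}_{A,B}\,x\ \langle\Gamma,y:A+B\rangle$; $\ \langle\Gamma,x:B\rangle\ y=\mathbf{right}_{A,B}\,x\ \langle\Gamma,y:A+B\rangle$; - if $\langle\Gamma,x_1:A\rangle M_1\langle\Sigma\rangle$ and $\langle\Gamma,x_2:B\rangle M_2\langle\Sigma\rangle$ then $\langle\Gamma,y:A+B\rangle\ \mathbf{case}\ y\ \mathbf{of}\ \{\mathbf{left}\ x_1\to M_1\mid\mathbf{right}\ x_2\to M_2\}\ \langle\Sigma\rangle$; - $\langle\Gamma,x_1:A,x_2:B\rangle\ x=(x_1,x_2)\ \langle\Gamma,x:A\otimes B\rangle$; $\ \langle\Gamma,x:A\otimes B\rangle\ (x_1,x_2)=x\ \langle\Gamma,x_1:A,x_2:B\rangle$; - $\langle\Gamma,x:A[\mu X.A/X]\rangle\ y=\mathbf{fold}_{\mu X.A}\,x\ \langle\Gamma,y:\mu X.A\rangle$; $\ \langle\Gamma,x:\mu X.A\rangle\ y=\mathbf{unfold}\,x\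 \langle\Gamma,y:A[\mu X.A/X]\rangle$. **Operational semantics.** Values are $v,w::=*\mid\mathbf{left}_{A,B}v\mid\mathbf{right}_{A,B}v\mid(v,w)\mid\mathbf{fold}_{\mu X.A}v$. A configuration $(M\mid V)$ is a term with an assignment $V$ of values to variables. The small-step relation $\leadsto$ is generated by $(\mathbf{new\ unit}\ u\mid V)\leadsto(\mathbf{skip}\mid V,u=*)$; $(\mathbf{discard}\ x\mid V,x=v)\leadsto(\mathbf{skip}\mid V)$; $(\mathbf{skip};P\mid V)\leadsto(P\mid V)$; $(P;Q\mid V)\leadsto(P';Q\mid V')$ whenever $(P\mid V)\leadsto(P'\mid V')$; $(\mathbf{while}\ b\ \mathbf{do}\ M\mid V,b=v)\leadsto(\mathbf{case}\ b\ \mathbf{of}\ \{\mathbf{left}\ u\to b=\mathbf{left}\,u\mid\mathbf{right}\ u\to b=\mathbf{right}\,u;(M;\mathbf{while}\ b\ \mathbf{do}\ M)\}\mid V,b=v)$ with $u$ fresh; $(y=\mathbf{left}\,x\mid V,x=v)\leadsto(\mathbf{skip}\mid V,y=\mathbf{left}\,v)$, and likewise for $\mathbf{right}$ and $\mathbf{fold}$;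 $(\mathbf{case}\ y\ \mathbf{of}\ \{\mathbf{left}\ x_1\to M_1\mid\mathbf{right}\ x_2\to M_2\}\mid V,y=\mathbf{left}\,v)\leadsto(M_1\mid V,x_1=v)$, and $\leadsto(M_2\mid V,x_2=v)$ if $y=\mathbf{right}\,v$; $(x=(x_1,x_2)\mid V,x_1=v_1,x_2=v_2)\leadsto(\mathbf{skip}\mid V,x=(v_1,v_2))$; $((x_1,x_2)=x\mid V,x=(v_1,v_2))\leadsto(\mathbf{skip}\mid V,x_1=v_1,x_2=v_2)$; $(y=\mathbf{unfold}\,x\mid V,x=\mathbf{fold}\,v)\leadsto(\mathbf{skip}\mid V,y=v)$. We write $(M\mid V)\Downarrow$ if $(M\mid V)\leadsto^*(\mathbf{skip}\mid V')$ for some $V'$. **Models.** A model is a symmetric monoidal category $(\mathbf C,\otimes,I)$ with an initial object and binary coproducts such that: $\otimes$ distributes over $+$; each atomic type $\mathbf A$ is assigned an object with a map $\diamond_{\mathbf A}:\mathbf A\to I$; $\mathbf C$ has all $\omega$-colimits and $\otimes$ is $\omega$-cocontinuous; every hom-set is a pointed dcpo with least element $\perp$, composition is Scott-continuous and strict in each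 argument, and $\otimes$ and copairing are Scott-continuous on hom-sets. The model is *computationally adequate* if $\mathrm{id}_I\neq\perp_{I,I}$. **Interpretation.** A type with $n$ free variables is interpreted as an $\omega$-cocontinuous functor $\mathbf C^n\to\mathbf C$: variables are projections, $I$ and $\mathbf A$ constants, $+$ and $\otimes$ pointwise, and $[\![\mu X.A]\!]$ is the parameterised initial algebra of $[\![A]\!]:\mathbf C^n\times\mathbf C\to\mathbf C$; $\mathrm{fold}:[\![A[\mu X.A/X]]\!]\cong[\![\mu X.A]\!]:\mathrm{unfold}$ is given by its structure map. The same clauses in the slice $\mathbf C/I$ (with $(\mathbf A,\diamond_{\mathbf A})$ for atomic types, and with parameterised initial algebras lying over those of $\mathbf C$) equip each $[\![A]\!]$ with a discarding map $\diamond_A:[\![A]\!]\to I$. Contexts are interpreted by tensor products, the empty one by $I$. Up to the structural isomorphisms, $[\![\vdash\langle\Gamma\rangle M\langle\Sigma\rangle]\!]:[\![\Gamma]\!]\to[\![\Sigma]\!]$ is: $\mathrm{id}$ for $\mathbf{new\ unit}$, $\mathbf{skip}$, pairing and unpairing; $\mathrm{id}\otimes\diamond$ for $\mathbf{discard}$;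 $[\![N]\!]\circ[\![M]\!]$ for $M;N$; $\mathrm{id}\otimes\mathrm{left}$, $\mathrm{id}\otimes\mathrm{right}$, $\mathrm{id}\otimes\mathrm{fold}$, $\mathrm{id}\otimes\mathrm{unfold}$ for the corresponding terms; $[[\![M_1]\!],[\![M_2]\!]]\circ d$ for $\mathbf{case}$, with $d:[\![\Gamma]\!]\otimes([\![A]\!]+[\![B]\!])\to([\![\Gamma]\!]\otimes[\![A]\!])+([\![\Gamma]\!]\otimes[\![B]\!])$ the distributivity isomorphism; and $\bigvee_{i}W^i(\perp)$ for $\mathbf{while}\ b\ \mathbf{do}\ M$, where $W(g)=[\mathrm{id}\otimes\mathrm{left},\ g\circ[\![M]\!]\circ(\mathrm{id}\otimes\mathrm{right})]\circ d$. **Theorem (Adequacy).** In every computationally adequate model, for every closed term $\vdash\langle\cdot\rangle\,M\,\langle\Sigma\rangle$, $$[\![M]\!]\neq\perp\quad\text{if and only if}\quad (M\mid\cdot)\Downarrow .$$ -/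

import Mathlib

namespace Lang

open CategoryTheory CategoryTheory.Limits CategoryTheory.Endofunctor CategoryTheory.Prod

universe w v₁ v₂ v₃ u₁ u₂ u₃

/-! ### Parameterised initial algebras -/

section ParamInitial

variable {A : Type u₁} [Category.{v₁} A] {B : Type u₂} [Category.{v₂} B]

/-- The action `T(f, g)` of a bifunctor on a pair of morphisms. -/
def bimap (T : A × B ⥤ B) {a a' : A} {b b' : B} (f : a ⟶ a') (g : b ⟶ b') :
    T.obj (a, b) ⟶ T.obj (a', b') :=
  T.map (f ×ₘ g)

theorem bimap_id (T : A × B ⥤ B) (a : A) (b : B) : bimap T (𝟙 a) (𝟙 b) = 𝟙 (T.obj (a, b)) :=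
  T.map_id (a, b)

theorem bimap_comp (T : A × B ⥤ B) {a a' a'' : A} {b b' b'' : B} (f : a ⟶ a') (g : b ⟶ b')
    (f' : a' ⟶ a'') (g' : b' ⟶ b'') :
    bimap T f g ≫ bimap T f' g' = bimap T (f ≫ f') (g ≫ g') :=
  (T.map_comp (f ×ₘ g) (f' ×ₘ g')).symm

theorem bimap_comp_assoc (T : A × B ⥤ B) {a a' a'' : A} {b b' b'' c : B} (f : a ⟶ a')
    (g : b ⟶ b') (f' : a' ⟶ a'') (g' : b' ⟶ b'') (h : T.obj (a'', b'') ⟶ c) :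
    bimap T f g ≫ bimap T f' g' ≫ h = bimap T (f ≫ f') (g ≫ g') ≫ h := by
  rw [← Category.assoc, bimap_comp]

/-- The endofunctor `T(a, -)`. -/
@[simps]
def sect (T : A × B ⥤ B) (a : A) : B ⥤ B where
  obj b := T.obj (a, b)
  map g := bimap T (𝟙 a) g
  map_id b := bimap_id T a b
  map_comp g g' := by rw [bimap_comp, Category.comp_id]

/-- A parameterised initial algebra of `T : A × B ⥤ B`. -/
structure ParamInitialAlgebra (T : A × B ⥤ B) where
  /-- the functor `T†` -/
  functor : A ⥤ B
  /-- the natural isomorphism `τ : T ∘ ⟨Id, T†⟩ ⇒ T†` -/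
  τ : (𝟭 A).prod' functor ⋙ T ≅ functor
  /-- every `(T† a, τ_a)` is an initial `T(a, -)`-algebra -/
  isInitial : ∀ a : A, IsInitial (⟨functor.obj a, τ.hom.app a⟩ : Algebra (sect T a))

/-- All endofunctors `T(a, -)` have an initial algebra. -/
class HasSectionAlgebras (T : A × B ⥤ B) : Prop where
  hasInitial : ∀ a : A, HasInitial (Algebra (sect T a))

attribute [instance] HasSectionAlgebras.hasInitial

/-- The chosen initial algebra of an endofunctor. It depends on the endofunctor only. -/
noncomputable def initAlg (F : B ⥤ B) [HasInitial (Algebra F)] : Algebra F := ⊥_ (Algebra F)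

section

variable (T : A × B ⥤ B) [HasSectionAlgebras T]

/-- The carrier of the chosen initial `T(a, -)`-algebra. -/
noncomputable def muObj (a : A) : B := (initAlg (sect T a)).a

/-- The structure map of the chosen initial `T(a, -)`-algebra. -/
noncomputable def muStr (a : A) : T.obj (a, muObj T a) ⟶ muObj T a := (initAlg (sect T a)).str

/-- The unique algebra morphism from the chosen initial `T(a, -)`-algebra to `(X, x)`. -/
noncomputable def muDesc (a : A) (X : B) (x : T.obj (a, X) ⟶ X) : muObj T a ⟶ X :=
  (initial.to (⟨X, x⟩ : Algebra (sect T a))).f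

theorem muStr_muDesc (a : A) (X : B) (x : T.obj (a, X) ⟶ X) :
    muStr T a ≫ muDesc T a X x = bimap T (𝟙 a) (muDesc T a X x) ≫ x :=
  (Algebra.Hom.h (initial.to (⟨X, x⟩ : Algebra (sect T a)))).symm

theorem muDesc_unique (a : A) (X : B) (x : T.obj (a, X) ⟶ X) (g : muObj T a ⟶ X)
    (hg : muStr T a ≫ g = bimap T (𝟙 a) g ≫ x) : g = muDesc T a X x :=
  congrArg Algebra.Hom.f (Limits.IsInitial.hom_ext (initialIsInitial (C := Algebra (sect T a)))
    (Algebra.Hom.mk (A₀ := ⊥_ (Algebra (sect T a))) (A₁ := ⟨X, x⟩) g hg.symm) (initial.to _))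

theorem muObj_hom_ext {a : A} {X : B} (x : T.obj (a, X) ⟶ X) {g h : muObj T a ⟶ X}
    (hg : muStr T a ≫ g = bimap T (𝟙 a) g ≫ x) (hh : muStr T a ≫ h = bimap T (𝟙 a) h ≫ x) :
    g = h :=
  (muDesc_unique T a X x g hg).trans (muDesc_unique T a X x h hh).symm

instance muStr_isIso (a : A) : IsIso (muStr T a) :=
  Algebra.Initial.str_isIso (A := initAlg (sect T a)) initialIsInitial

/-- The action of `T†` on morphisms. -/
noncomputable def muMap {a b : A} (f : a ⟶ b) : muObj T a ⟶ muObj T b :=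
  muDesc T a (muObj T b) (bimap T f (𝟙 _) ≫ muStr T b)

theorem muStr_muMap {a b : A} (f : a ⟶ b) :
    muStr T a ≫ muMap T f = bimap T f (muMap T f) ≫ muStr T b := by
  rw [muMap, muStr_muDesc, bimap_comp_assoc, Category.comp_id, Category.id_comp]

theorem muMap_unique {a b : A} (f : a ⟶ b) (g : muObj T a ⟶ muObj T b)
    (h : muStr T a ≫ g = bimap T f g ≫ muStr T b) : g = muMap T f := by
  apply muDesc_unique
  rw [h, bimap_comp_assoc, Category.comp_id, Category.id_comp]

/-- The functor `T†`, which sends `a` to the carrier of the chosen initial `T(a, -)`-algebra. -/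
noncomputable def dagger : A ⥤ B where
  obj a := muObj T a
  map f := muMap T f
  map_id a := by
    symm
    apply muMap_unique
    rw [Category.comp_id, bimap_id, Category.id_comp]
  map_comp {a b c} f g := by
    symm
    apply muMap_unique
    rw [← Category.assoc, muStr_muMap, Category.assoc, muStr_muMap, bimap_comp_assoc]

/-- `dagger T` is a parameterised initial algebra of `T`. -/
noncomputable def daggerAlgebra : ParamInitialAlgebra T where
  functor := dagger T
  τ := NatIso.ofComponents (fun a => @asIso _ _ _ _ (muStr T a) (muStr_isIso T a)) fun f => (muStr_muMap T f).symm
  isInitial _ := initialIsInitial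

end

end ParamInitial

section Adamek

variable {B : Type u₂} [Category.{v₂} B]

/-- The objects `Fⁿ ∅` of the initial sequence of `F`. -/
noncomputable def chainObj [HasInitial B] (F : B ⥤ B) : ℕ → B
  | 0 => ⊥_ B
  | n + 1 => F.obj (chainObj F n)

/-- The morphisms `Fⁿ ∅ ⟶ Fⁿ⁺¹ ∅` of the initial sequence of `F`. -/
noncomputable def chainStep [HasInitial B] (F : B ⥤ B) : ∀ n, chainObj F n ⟶ chainObj F (n + 1)
  | 0 => initial.to _
  | n + 1 => F.map (chainStep F n)

/-- The canonical morphisms from the initial sequence of `F` to an `F`-algebra. -/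
noncomputable def chainDesc [HasInitial B] (F : B ⥤ B) (X : Algebra F) : ∀ n, chainObj F n ⟶ X.a
  | 0 => initial.to _
  | n + 1 => F.map (chainDesc F X n) ≫ X.str

theorem chainStep_desc [HasInitial B] (F : B ⥤ B) (X : Algebra F) (n : ℕ) :
    chainStep F n ≫ chainDesc F X (n + 1) = chainDesc F X n := by
  induction n with
  | zero => exact initialIsInitial.hom_ext _ _
  | succ n ih =>
    have h : F.map (chainStep F n) ≫ F.map (chainDesc F X (n + 1)) ≫ X.str =
        F.map (chainDesc F X n) ≫ X.str := by rw [← F.map_comp_assoc, ih]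
    exact h

theorem hasInitial_algebra [HasInitial B] [HasColimitsOfShape ℕ B] (F : B ⥤ B)
    [PreservesColimitsOfShape ℕ F] : HasInitial (Algebra F) := by
  let D : ℕ ⥤ B := Functor.ofSequence (chainStep F)
  have hD : ∀ n, D.map (homOfLE (Nat.le_add_right n 1)) = chainStep F n :=
    fun n => Functor.ofSequence_map_homOfLE_succ _ n
  let L := colimit D
  let i : ∀ n, D.obj n ⟶ L := fun n => colimit.ι D n
  have hi : ∀ n, D.map (homOfLE (Nat.le_add_right n 1)) ≫ i (n + 1) = i n := fun n =>
    colimit.w D _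
  let c : Cocone (D ⋙ F) := ⟨L, NatTrans.ofSequence (F := D ⋙ F) (G := (Functor.const ℕ).obj L)
    (fun n => i (n + 1)) (fun n => by
      have h1 : (D ⋙ F).map (homOfLE (Nat.le_add_right n 1)) =
        D.map (homOfLE (Nat.le_add_right (n + 1) 1)) := (congrArg F.map (hD n)).trans (hD (n + 1)).symm
      exact (congrArg (· ≫ i (n + 1 + 1)) h1).trans ((hi (n + 1)).trans (Category.comp_id _).symm))⟩
  let hF := isColimitOfPreserves F (colimit.isColimit D)
  let s : F.obj L ⟶ L := hF.desc c
  have hs : ∀ n, F.map (i n) ≫ s = i (n + 1) := fun n => hF.fac c n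
  have hext : ∀ {Z : B} (f g : L ⟶ Z), (∀ n, i n ≫ f = i n ≫ g) → f = g :=
    fun f g h => colimit.hom_ext h
  have hext' : ∀ {Z : B} (f g : F.obj L ⟶ Z),
      (∀ n, F.map (i n) ≫ f = F.map (i n) ≫ g) → f = g :=
    fun f g h => hF.hom_ext h
  let d : ∀ X : Algebra F, L ⟶ X.a := fun X =>
    colimit.desc D ⟨X.a, NatTrans.ofSequence (F := D) (G := (Functor.const ℕ).obj X.a)
      (fun n => chainDesc F X n) (fun n => by
        exact (congrArg (· ≫ chainDesc F X (n + 1)) (hD n)).trans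
          ((chainStep_desc F X n).trans (Category.comp_id _).symm))⟩
  have hd : ∀ X n, i n ≫ d X = chainDesc F X n := fun X n => colimit.ι_desc _ n
  have key : IsInitial (⟨L, s⟩ : Algebra F) := by
    refine IsInitial.ofUniqueHom (fun X => ⟨d X, ?_⟩) ?_
    · apply hext'
      intro n
      have h1 : F.map (i n) ≫ F.map (d X) ≫ X.str = F.map (chainDesc F X n) ≫ X.str := by
        rw [← F.map_comp_assoc, hd]; rfl
      have h2 : F.map (i n) ≫ s ≫ d X = i (n + 1) ≫ d X :=
        (Category.assoc _ _ _).symm.trans (congrArg (· ≫ d X) (hs n))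
      exact h1.trans (h2.trans (hd X (n + 1))).symm
    · intro X m
      apply Algebra.Hom.ext
      apply hext
      intro n
      refine Eq.trans ?_ (hd X n).symm
      induction n with
      | zero => exact initialIsInitial.hom_ext _ _
      | succ n ih =>
        have h1 : i (n + 1) ≫ m.f = F.map (i n) ≫ s ≫ m.f :=
          (congrArg (· ≫ m.f) (hs n)).symm.trans (Category.assoc _ _ _)
        have h2 : F.map (i n) ≫ s ≫ m.f = F.map (i n) ≫ F.map m.f ≫ X.str :=
          congrArg (F.map (i n) ≫ ·) m.h.symm
        have h3 : F.map (i n) ≫ F.map m.f ≫ X.str = F.map (i n ≫ m.f) ≫ X.str := by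
          rw [F.map_comp_assoc]
        exact h1.trans (h2.trans (h3.trans (by rw [ih]; rfl)))
  exact key.hasInitial

end Adamek

section Cocontinuous

variable {A : Type u₁} [Category.{v₁} A] {B : Type u₂} [Category.{v₂} B]

/-- Two families of colimit cocones over the same shape give one in the product. -/
def isColimitProd {D : Type u₃} [Category.{v₃} D] {K : ℕ ⥤ A × D} (c : Cocone K)
  (h₁ : IsColimit ((CategoryTheory.Prod.fst A D).mapCocone c)) (h₂ : IsColimit ((CategoryTheory.Prod.snd A D).mapCocone c)) :
  IsColimit c where
  desc s := (h₁.desc ((CategoryTheory.Prod.fst A D).mapCocone s)) ×ₘ (h₂.desc ((CategoryTheory.Prod.snd A D).mapCocone s))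
  fac s j := Prod.hom_ext (h₁.fac ((CategoryTheory.Prod.fst A D).mapCocone s) j)
    (h₂.fac ((CategoryTheory.Prod.snd A D).mapCocone s) j)
  uniq s m hm := Prod.hom_ext
    (h₁.uniq ((CategoryTheory.Prod.fst A D).mapCocone s) m.1 fun j => congrArg _root_.Prod.fst (hm j))
    (h₂.uniq ((CategoryTheory.Prod.snd A D).mapCocone s) m.2 fun j => congrArg _root_.Prod.snd (hm j))

theorem preserves_prod' {E : Type u₁} [Category.{v₁} E] {D : Type u₃} [Category.{v₃} D]
    (F : E ⥤ A) (G : E ⥤ D)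
    [PreservesColimitsOfShape ℕ F] [PreservesColimitsOfShape ℕ G] :
    PreservesColimitsOfShape ℕ (F.prod' G) where
  preservesColimit := ⟨fun hc => ⟨isColimitProd _
      (isColimitOfPreserves F hc) (isColimitOfPreserves G hc)⟩⟩

/-- Constant functors preserve ω-colimits. -/
theorem preserves_const (b : B) : PreservesColimitsOfShape ℕ ((Functor.const A).obj b) where
  preservesColimit := ⟨fun _ => ⟨{
    desc := fun s => s.ι.app 0
    fac := fun s j => by
      have h0 := s.w (homOfLE (Nat.zero_le j))
      have h1 : s.ι.app j = s.ι.app 0 := (Category.id_comp _).symm.trans h0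
      exact (Category.id_comp _).trans h1.symm
    uniq := fun s m hm => (Category.id_comp _).symm.trans (hm 0) }⟩⟩

theorem preserves_sect [HasColimitsOfShape ℕ B] (T : A × B ⥤ B) [PreservesColimitsOfShape ℕ T]
    (a : A) : PreservesColimitsOfShape ℕ (sect T a) := by
  have := preserves_const (A := B) a
  have : PreservesColimitsOfShape ℕ (((Functor.const B).obj a).prod' (𝟭 B)) :=
    { preservesColimit := fun {K} => ⟨fun {c} hc => ⟨isColimitProd _
      (isColimitOfPreserves ((Functor.const B).obj a) hc) (isColimitOfPreserves (𝟭 B) hc)⟩⟩ }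
  have : PreservesColimitsOfShape ℕ (((Functor.const B).obj a).prod' (𝟭 B) ⋙ T) := inferInstance
  exact this

instance hasSectionAlgebras [HasInitial B] [HasColimitsOfShape ℕ B] (T : A × B ⥤ B)
    [PreservesColimitsOfShape ℕ T] : HasSectionAlgebras T where
  hasInitial a :=
    have := preserves_sect T a
    hasInitial_algebra (sect T a)

theorem isIso_of_colimit (T : A × B ⥤ B) [HasSectionAlgebras T] {J : Type} (a : J → A) (c : A)
    (i : ∀ j, a j ⟶ c) (L : B) (e : ∀ j, muObj T (a j) ⟶ L) (s : T.obj (c, L) ⟶ L)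
    (hs : ∀ j, bimap T (i j) (e j) ≫ s = muStr T (a j) ≫ e j)
    (hext : ∀ {Z : B} (f g : T.obj (c, L) ⟶ Z),
      (∀ j, bimap T (i j) (e j) ≫ f = bimap T (i j) (e j) ≫ g) → f = g)
    (hext' : ∀ {Z : B} (f g : L ⟶ Z), (∀ j, e j ≫ f = e j ≫ g) → f = g)
    (φ : L ⟶ muObj T c) (hφ : ∀ j, e j ≫ φ = muMap T (i j)) : IsIso φ := by
  have hφs : s ≫ φ = bimap T (𝟙 _) φ ≫ muStr T c := by
    apply hext
    intro j
    rw [← Category.assoc, hs, Category.assoc, hφ, muStr_muMap, bimap_comp_assoc, hφ,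
      Category.comp_id]
  have hψ := muStr_muDesc T c L s
  set ψ := muDesc T c L s
  refine ⟨ψ, ?_, ?_⟩
  · apply hext'
    intro j
    rw [← Category.assoc, hφ, Category.comp_id]
    apply muObj_hom_ext T (bimap T (i j) (𝟙 L) ≫ s)
    · rw [← Category.assoc, muStr_muMap, Category.assoc, hψ, bimap_comp_assoc, bimap_comp_assoc,
        Category.comp_id, Category.comp_id, Category.id_comp]
    · rw [← hs, bimap_comp_assoc, Category.comp_id, Category.id_comp]
  · apply muObj_hom_ext T (muStr T c)
    · rw [← Category.assoc, hψ, Category.assoc, hφs, bimap_comp_assoc, Category.comp_id]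
    · rw [bimap_id, Category.comp_id, Category.id_comp]

theorem preserves_dagger [HasInitial B] [HasColimitsOfShape ℕ B] (T : A × B ⥤ B)
    [PreservesColimitsOfShape ℕ T] : PreservesColimitsOfShape ℕ (dagger T) where
  preservesColimit {K} := ⟨fun {c} hc => by
    let E := colimit.cocone (K ⋙ dagger T)
    let hE : IsColimit E := colimit.isColimit _
    let P : Cocone (K ⋙ (𝟭 A).prod' (dagger T)) :=
      ⟨(c.pt, E.pt), { app := fun j => (c.ι.app j) ×ₘ (E.ι.app j)
                       naturality := fun i j f =>
                        Prod.hom_ext (c.ι.naturality f) (E.ι.naturality f) }⟩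
    let hP : IsColimit P := isColimitProd P hc hE
    let hT := isColimitOfPreserves T hP
    let e : ∀ j, muObj T (K.obj j) ⟶ E.pt := fun j => E.ι.app j
    let Q : Cocone ((K ⋙ (𝟭 A).prod' (dagger T)) ⋙ T) :=
      ⟨E.pt, { app := fun j => muStr T (K.obj j) ≫ e j
               naturality := fun i j f => by
                have h2 : muMap T (K.map f) ≫ e j = e i := E.w f
                have h3 : bimap T (K.map f) (muMap T (K.map f)) ≫ muStr T (K.obj j) ≫ e j
                    = muStr T (K.obj i) ≫ e i := by
                  rw [← Category.assoc, ← muStr_muMap, Category.assoc, h2]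
                exact h3.trans (Category.comp_id _).symm }⟩
    have : IsIso (hE.desc ((dagger T).mapCocone c)) :=
      isIso_of_colimit T K.obj c.pt (fun j => c.ι.app j) E.pt e (hT.desc Q) (fun j => hT.fac Q j)
        (fun f g h => hT.hom_ext h) (fun f g h => hE.hom_ext h) _ (fun j => hE.fac _ j)
    exact ⟨IsColimit.ofPointIso hE (i := this)⟩⟩

end Cocontinuous

/-! ### Models -/

section Model

variable (C : Type u₁) [Category.{v₁} C]

/-- A chosen initial object and chosen binary coproducts. -/
class ChosenCoproducts where
  /-- the initial object -/
  empty : C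
  isInitial : IsInitial empty
  /-- the binary coproduct `X + Y` -/
  sum : C → C → C
  left : ∀ X Y : C, X ⟶ sum X Y
  right : ∀ X Y : C, Y ⟶ sum X Y
  isCoproduct : ∀ X Y : C, IsColimit (BinaryCofan.mk (left X Y) (right X Y))

/-- Enrichment in pointed dcpos and strict Scott-continuous maps (with the smash product): every
hom-set is a pointed dcpo, composition is Scott-continuous and strict in each argument. -/
class DcpoEnriched where
  /-- `CompletePartialOrder` is Mathlib's notion of a pointed dcpo. -/
  dcpo : ∀ X Y : C, CompletePartialOrder (X ⟶ Y)
  comp_scott : ∀ X Y Z : C, ScottContinuous fun p : (X ⟶ Y) × (Y ⟶ Z) => p.1 ≫ p.2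
  bot_comp : ∀ {X Y Z : C} (g : Y ⟶ Z), (⊥ : X ⟶ Y) ≫ g = ⊥
  comp_bot : ∀ {X Y Z : C} (f : X ⟶ Y), f ≫ (⊥ : Y ⟶ Z) = ⊥

attribute [reducible, instance] DcpoEnriched.dcpo

variable {C}

/-- The copairing `[f, g] : X + Y ⟶ Z`. -/
def copair [ChosenCoproducts C] {X Y Z : C} (f : X ⟶ Z) (g : Y ⟶ Z) :
    ChosenCoproducts.sum X Y ⟶ Z :=
  (ChosenCoproducts.isCoproduct X Y).desc (BinaryCofan.mk f g)

open ChosenCoproducts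

@[simp]
theorem left_copair [ChosenCoproducts C] {X Y Z : C} (f : X ⟶ Z) (g : Y ⟶ Z) :
    left X Y ≫ copair f g = f :=
  (isCoproduct X Y).fac (BinaryCofan.mk f g) ⟨WalkingPair.left⟩

@[simp]
theorem right_copair [ChosenCoproducts C] {X Y Z : C} (f : X ⟶ Z) (g : Y ⟶ Z) :
    right X Y ≫ copair f g = g :=
  (isCoproduct X Y).fac (BinaryCofan.mk f g) ⟨WalkingPair.right⟩

theorem sum_hom_ext [ChosenCoproducts C] {X Y Z : C} {f g : ChosenCoproducts.sum X Y ⟶ Z}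
    (h₁ : left X Y ≫ f = left X Y ≫ g) (h₂ : right X Y ≫ f = right X Y ≫ g) : f = g :=
  BinaryCofan.IsColimit.hom_ext (isCoproduct X Y) h₁ h₂

@[simp]
theorem left_copair_assoc [ChosenCoproducts C] {X Y Z W : C} (f : X ⟶ Z) (g : Y ⟶ Z) (h : Z ⟶ W) :
    left X Y ≫ copair f g ≫ h = f ≫ h := by
  rw [← Category.assoc, left_copair]

@[simp]
theorem right_copair_assoc [ChosenCoproducts C] {X Y Z W : C} (f : X ⟶ Z) (g : Y ⟶ Z)
    (h : Z ⟶ W) : right X Y ≫ copair f g ≫ h = g ≫ h := by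
  rw [← Category.assoc, right_copair]

theorem left_of_copair_comp [ChosenCoproducts C] {X Y X' Y' Z : C} {f : X ⟶ X'} {g : Y ⟶ Y'}
    {m : ChosenCoproducts.sum X' Y' ⟶ Z} {k : ChosenCoproducts.sum X Y ⟶ Z}
    (h : copair (f ≫ left X' Y') (g ≫ right X' Y') ≫ m = k) :
    f ≫ left X' Y' ≫ m = left X Y ≫ k := by
  rw [← h, left_copair_assoc, Category.assoc]

theorem right_of_copair_comp [ChosenCoproducts C] {X Y X' Y' Z : C} {f : X ⟶ X'} {g : Y ⟶ Y'}
    {m : ChosenCoproducts.sum X' Y' ⟶ Z} {k : ChosenCoproducts.sum X Y ⟶ Z}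
    (h : copair (f ≫ left X' Y') (g ≫ right X' Y') ≫ m = k) :
    g ≫ right X' Y' ≫ m = right X Y ≫ k := by
  rw [← h, right_copair_assoc, Category.assoc]

/-- The coproduct bifunctor. -/
def sumFunctor (C : Type u₁) [Category.{v₁} C] [ChosenCoproducts C] : C × C ⥤ C where
  obj X := ChosenCoproducts.sum X.1 X.2
  map f := copair (f.1 ≫ left _ _) (f.2 ≫ right _ _)
  map_id X := sum_hom_ext (by simp) (by simp)
  map_comp f g := sum_hom_ext (by simp) (by simp)

open MonoidalCategory

/-- The canonical map `[id ⊗ left, id ⊗ right] : (X ⊗ Y) + (X ⊗ Z) ⟶ X ⊗ (Y + Z)`. -/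
def distribMap [MonoidalCategory C] [ChosenCoproducts C] (X Y Z : C) :
    ChosenCoproducts.sum (X ⊗ Y) (X ⊗ Z) ⟶ X ⊗ ChosenCoproducts.sum Y Z :=
  copair (X ◁ left Y Z) (X ◁ right Y Z)

/-- The categorical models of the language, up to the interpretation of the atomic types.
Here `ω` is the category `ℕ`, and `ω`-cocontinuity of `⊗` refers to the bifunctor `C × C ⥤ C`. -/
class Model (C : Type u₁) [Category.{v₁} C] [MonoidalCategory C] [SymmetricCategory C] extends
    ChosenCoproducts C, DcpoEnriched C where
  distrib_isIso : ∀ X Y Z : C, IsIso (distribMap X Y Z)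
  hasOmegaColimits : HasColimitsOfShape ℕ C
  tensor_cocontinuous : PreservesColimitsOfShape ℕ (MonoidalCategory.tensor C)
  tensor_scott : ∀ W X Y Z : C, ScottContinuous fun p : (W ⟶ X) × (Y ⟶ Z) => p.1 ⊗ₘ p.2
  copair_scott : ∀ X Y Z : C, ScottContinuous fun p : (X ⟶ Z) × (Y ⟶ Z) => copair p.1 p.2

attribute [instance] Model.distrib_isIso Model.hasOmegaColimits Model.tensor_cocontinuous

/-- The interpretation of the atomic types: objects with discarding maps. -/
structure AtomInterp (𝒜 : Type u₂) (C : Type u₁) [Category.{v₁} C] [MonoidalCategory C] where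
  obj : 𝒜 → C
  discard : ∀ a, obj a ⟶ 𝟙_ C

instance [ChosenCoproducts C] : HasInitial C :=
  (ChosenCoproducts.isInitial (C := C)).hasInitial

instance preserves_sum [ChosenCoproducts C] : PreservesColimitsOfShape ℕ (sumFunctor C) where
  preservesColimit {K} := ⟨fun {c} hc => by
    -- a cocone over `K ⋙ (+)` amounts to a cocone over each of the two components of `K`
    let t : ∀ s : Cocone (K ⋙ sumFunctor C), Cocone K := fun s =>
      ⟨(s.pt, s.pt),
        { app := fun j => (left _ _ ≫ s.ι.app j) ×ₘ (right _ _ ≫ s.ι.app j)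
          naturality := fun i j f => Prod.hom_ext
            ((left_of_copair_comp (s.w f)).trans (Category.comp_id _).symm)
            ((right_of_copair_comp (s.w f)).trans (Category.comp_id _).symm) }⟩
    refine ⟨{ desc := fun s => copair (hc.desc (t s)).1 (hc.desc (t s)).2, fac := ?_, uniq := ?_ }⟩
    · intro s j
      have h1 : (c.ι.app j).1 ≫ (hc.desc (t s)).1 = left _ _ ≫ s.ι.app j :=
        congrArg _root_.Prod.fst (hc.fac (t s) j)
      have h2 : (c.ι.app j).2 ≫ (hc.desc (t s)).2 = right _ _ ≫ s.ι.app j :=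
        congrArg _root_.Prod.snd (hc.fac (t s) j)
      have h3 : copair ((c.ι.app j).1 ≫ left _ _) ((c.ι.app j).2 ≫ right _ _) ≫
          copair (hc.desc (t s)).1 (hc.desc (t s)).2 = s.ι.app j := by
        refine sum_hom_ext ?_ ?_
        · rw [left_copair_assoc, Category.assoc, left_copair]; exact h1
        · rw [right_copair_assoc, Category.assoc, right_copair]; exact h2
      exact h3
    · intro s m hm
      have h : (left _ _ ≫ m) ×ₘ (right _ _ ≫ m) = hc.desc (t s) :=
        hc.uniq (t s) ((left _ _ ≫ m) ×ₘ (right _ _ ≫ m)) fun j =>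
          Prod.hom_ext (left_of_copair_comp (hm j)) (right_of_copair_comp (hm j))
      exact sum_hom_ext ((congrArg _root_.Prod.fst h).trans (left_copair _ _).symm)
        ((congrArg _root_.Prod.snd h).trans (right_copair _ _).symm)⟩

end Model

/-! ### Types -/

/-- Well-formed types `Θ ⊢ A` over the atomic types `𝒜`, up to renaming of bound variables: the
free type variables are numbered by `Fin n` with `n = |Θ|`, and `μ` binds the variable `0`. -/
inductive Ty (𝒜 : Type u₂) : ℕ → Type u₂
  | var {n : ℕ} (i : Fin n) : Ty 𝒜 n
  | unit {n : ℕ} : Ty 𝒜 n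
  | atom {n : ℕ} (a : 𝒜) : Ty 𝒜 n
  | sum {n : ℕ} (A B : Ty 𝒜 n) : Ty 𝒜 n
  | tensor {n : ℕ} (A B : Ty 𝒜 n) : Ty 𝒜 n
  | mu {n : ℕ} (A : Ty 𝒜 (n + 1)) : Ty 𝒜 n

namespace Ty

variable {𝒜 : Type u₂}

/-- The type `bit = I + I`. -/
abbrev bit : Ty 𝒜 0 := .sum .unit .unit

/-- Renaming of free type variables. -/
def rename : {n : ℕ} → Ty 𝒜 n → {m : ℕ} → (Fin n → Fin m) → Ty 𝒜 m
  | _, var i, _, ρ => var (ρ i)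
  | _, unit, _, _ => unit
  | _, atom a, _, _ => atom a
  | _, sum A B, _, ρ => sum (A.rename ρ) (B.rename ρ)
  | _, tensor A B, _, ρ => tensor (A.rename ρ) (B.rename ρ)
  | _, mu A, _, ρ => mu (A.rename (Fin.cons 0 fun i => (ρ i).succ))

/-- Simultaneous capture-avoiding substitution. -/
def subst : {n : ℕ} → Ty 𝒜 n → {m : ℕ} → (Fin n → Ty 𝒜 m) → Ty 𝒜 m
  | _, var i, _, σ => σ i
  | _, unit, _, _ => unit
  | _, atom a, _, _ => atom a
  | _, sum A B, _, σ => sum (A.subst σ) (B.subst σ)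
  | _, tensor A B, _, σ => tensor (A.subst σ) (B.subst σ)
  | _, mu A, _, σ => mu (A.subst (Fin.cons (var 0) fun i => (σ i).rename Fin.succ))

/-- The type `A[μX.A / X]`. -/
def unroll (A : Ty 𝒜 1) : Ty 𝒜 0 := A.subst (Fin.cons (mu A) var)

end Ty

/-! ### Interpretation of types -/

section Interp

/-- The functor `Dⁿ × D ⥤ Dⁿ⁺¹` which adds a new `0`-th component. -/
def consFunctor (D : Type u₁) [Category.{v₁} D] (n : ℕ) : (Fin n → D) × D ⥤ (Fin (n + 1) → D) where
  obj X := Fin.cons (α := fun _ => D) X.2 X.1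
  map {X Y} f := fun i => Fin.cases (motive := fun i =>
    (Fin.cons (α := fun _ => D) X.2 X.1 i : D) ⟶ Fin.cons (α := fun _ => D) Y.2 Y.1 i) f.2 f.1 i
  map_id X := by
    funext i
    refine Fin.cases ?_ (fun j => ?_) i <;> rfl
  map_comp f g := by
    funext i
    refine Fin.cases ?_ (fun j => ?_) i <;> rfl

theorem preserves_pi {E : Type u₁} [Category.{v₁} E] {D : Type u₂} [Category.{v₂} D] {n : ℕ}
    (F : E ⥤ (Fin n → D))
    (h : ∀ i, PreservesColimitsOfShape ℕ (F ⋙ Pi.eval (fun _ => D) i)) :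
    PreservesColimitsOfShape ℕ F where
  preservesColimit := ⟨fun hc => ⟨
    let P := fun i => isColimitOfPreserves (F ⋙ Pi.eval (fun _ => D) i) hc
    { desc := fun s i => (P i).desc ((Pi.eval (fun _ => D) i).mapCocone s)
      fac := fun s j => funext fun i => (P i).fac ((Pi.eval (fun _ => D) i).mapCocone s) j
      uniq := fun s m hm => funext fun i =>
        (P i).uniq ((Pi.eval (fun _ => D) i).mapCocone s) (m i) fun j => congrFun (hm j) i }⟩⟩

theorem preserves_fst {E : Type u₁} [Category.{v₁} E] {D : Type u₂} [Category.{v₂} D] :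
    PreservesColimitsOfShape ℕ (CategoryTheory.Prod.fst E D) where
  preservesColimit {K} := ⟨fun {c} hc => ⟨
    let t : Cocone (K ⋙ CategoryTheory.Prod.fst E D) → Cocone K := fun s =>
      ⟨(s.pt, c.pt.2), { app := fun j => s.ι.app j ×ₘ (c.ι.app j).2
                         naturality := fun _ _ f => Prod.hom_ext (s.ι.naturality f)
                          (Prod.hom_ext_iff.1 (c.ι.naturality f)).2 }⟩
    { desc := fun s => (hc.desc (t s)).1
      fac := fun s j => congrArg _root_.Prod.fst (hc.fac (t s) j)
      uniq := fun s m hm => congrArg _root_.Prod.fst (hc.uniq (t s) (m ×ₘ 𝟙 _) fun j =>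
        Prod.hom_ext (hm j) (Category.comp_id _)) }⟩⟩

theorem preserves_snd {E : Type u₁} [Category.{v₁} E] {D : Type u₂} [Category.{v₂} D] :
    PreservesColimitsOfShape ℕ (CategoryTheory.Prod.snd E D) where
  preservesColimit {K} := ⟨fun {c} hc => ⟨
    let t : Cocone (K ⋙ CategoryTheory.Prod.snd E D) → Cocone K := fun s =>
      ⟨(c.pt.1, s.pt), { app := fun j => (c.ι.app j).1 ×ₘ s.ι.app j
                         naturality := fun _ _ f => Prod.hom_ext
                          (Prod.hom_ext_iff.1 (c.ι.naturality f)).1 (s.ι.naturality f) }⟩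
    { desc := fun s => (hc.desc (t s)).2
      fac := fun s j => congrArg _root_.Prod.snd (hc.fac (t s) j)
      uniq := fun s m hm => congrArg _root_.Prod.snd (hc.uniq (t s) (𝟙 _ ×ₘ m) fun j =>
        Prod.hom_ext (Category.comp_id _) (hm j)) }⟩⟩

theorem preserves_eval (D : Type u₁) [Category.{v₁} D] [HasColimitsOfShape ℕ D] (n : ℕ)
    (i : Fin n) : PreservesColimitsOfShape ℕ (Pi.eval (fun _ : Fin n => D) i) where
  preservesColimit {K} := by
    let P := fun i => colimit.isColimit (K ⋙ Pi.eval (fun _ : Fin n => D) i)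
    let c : Cocone K := ⟨fun i => colimit (K ⋙ Pi.eval (fun _ : Fin n => D) i),
      { app := fun j i => colimit.ι (K ⋙ Pi.eval (fun _ : Fin n => D) i) j
        naturality := fun j j' f => funext fun i =>
          (colimit.cocone (K ⋙ Pi.eval (fun _ : Fin n => D) i)).ι.naturality f }⟩
    have hc : IsColimit c :=
      { desc := fun s i => (P i).desc ((Pi.eval (fun _ => D) i).mapCocone s)
        fac := fun s j => funext fun i => (P i).fac ((Pi.eval (fun _ => D) i).mapCocone s) j
        uniq := fun s m hm => funext fun i =>
          (P i).uniq ((Pi.eval (fun _ => D) i).mapCocone s) (m i) fun j => congrFun (hm j) i }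
    exact preservesColimit_of_preserves_colimit_cocone hc (P i)

instance preserves_consFunctor (D : Type u₁) [Category.{v₁} D] [HasColimitsOfShape ℕ D] (n : ℕ) :
    PreservesColimitsOfShape ℕ (consFunctor D n) := by
  refine preserves_pi _ fun i => ?_
  refine Fin.cases ?_ (fun j => ?_) i
  · exact preserves_snd (E := Fin n → D) (D := D)
  · have h1 := preserves_fst (E := Fin n → D) (D := D)
    have h2 := preserves_eval D n j
    have h3 : PreservesColimitsOfShape ℕ
      (CategoryTheory.Prod.fst (Fin n → D) D ⋙ Pi.eval (fun _ : Fin n => D) j) := inferInstance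
    exact h3

variable {𝒜 : Type u₂} {C : Type u₁} [Category.{v₁} C] [MonoidalCategory C] [SymmetricCategory C]
  [Model C]

open MonoidalCategory

/-- The interpretation of a type as a functor, together with its `ω`-cocontinuity. -/
noncomputable def Ty.interpAux (κ : AtomInterp 𝒜 C) : {n : ℕ} → Ty 𝒜 n →
    {F : (Fin n → C) ⥤ C // PreservesColimitsOfShape ℕ F}
  | n, .var i => ⟨Pi.eval (fun _ => C) i, preserves_eval C n i⟩
  | _, .unit => ⟨(Functor.const _).obj (𝟙_ C), preserves_const _⟩
  | _, .atom a => ⟨(Functor.const _).obj (κ.obj a), preserves_const _⟩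
  | _, .sum A B =>
    ⟨(A.interpAux κ).1.prod' (B.interpAux κ).1 ⋙ sumFunctor C,
      have := (A.interpAux κ).2
      have := (B.interpAux κ).2
      have := preserves_prod' (A.interpAux κ).1 (B.interpAux κ).1
      inferInstance⟩
  | _, .tensor A B =>
    ⟨(A.interpAux κ).1.prod' (B.interpAux κ).1 ⋙ MonoidalCategory.tensor C,
      have := (A.interpAux κ).2
      have := (B.interpAux κ).2
      have := preserves_prod' (A.interpAux κ).1 (B.interpAux κ).1
      inferInstance⟩
  | n, .mu A =>
    have := (A.interpAux κ).2
    ⟨dagger (consFunctor C n ⋙ (A.interpAux κ).1), preserves_dagger _⟩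

/-- The standard interpretation `⟦Θ ⊢ A⟧ : Cⁿ ⥤ C` of a type. -/
noncomputable def Ty.interp (κ : AtomInterp 𝒜 C) {n : ℕ} (A : Ty 𝒜 n) : (Fin n → C) ⥤ C :=
  (A.interpAux κ).1

instance (κ : AtomInterp 𝒜 C) {n : ℕ} (A : Ty 𝒜 n) : PreservesColimitsOfShape ℕ (A.interp κ) :=
  (A.interpAux κ).2

/-- The functor `⟦Θ, X ⊢ A⟧ : Cⁿ × C ⥤ C`. -/
noncomputable abbrev Ty.bodyFunctor (κ : AtomInterp 𝒜 C) {n : ℕ} (A : Ty 𝒜 (n + 1)) :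
    (Fin n → C) × C ⥤ C :=
  consFunctor C n ⋙ A.interp κ

theorem Ty.interp_mu (κ : AtomInterp 𝒜 C) {n : ℕ} (A : Ty 𝒜 (n + 1)) :
    (Ty.mu A).interp κ = dagger (A.bodyFunctor κ) := rfl

theorem Ty.interp_sum (κ : AtomInterp 𝒜 C) {n : ℕ} (A B : Ty 𝒜 n) :
    (Ty.sum A B).interp κ = (A.interp κ).prod' (B.interp κ) ⋙ sumFunctor C := rfl

theorem Ty.interp_tensor (κ : AtomInterp 𝒜 C) {n : ℕ} (A B : Ty 𝒜 n) :
    (Ty.tensor A B).interp κ = (A.interp κ).prod' (B.interp κ) ⋙ MonoidalCategory.tensor C := rfl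

/-! #### Substitution -/

theorem dagger_congr {A : Type u₁} [Category.{v₁} A] {B : Type u₂} [Category.{v₂} B]
    {T T' : A × B ⥤ B} [HasSectionAlgebras T] [HasSectionAlgebras T'] (h : T = T') :
    dagger T = dagger T' := by
  subst h; rfl

theorem initAlg_str_heq {B : Type u₂} [Category.{v₂} B] {F G : B ⥤ B} [HasInitial (Algebra F)]
    [HasInitial (Algebra G)] (h : F = G) : (initAlg F).str ≍ (initAlg G).str := by
  subst h; rfl

theorem initDesc_heq {B : Type u₂} [Category.{v₂} B] {F G : B ⥤ B} [HasInitial (Algebra F)]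
    [HasInitial (Algebra G)] (h : F = G) {X Y : B} (hX : X = Y) {x : F.obj X ⟶ X}
    {y : G.obj Y ⟶ Y} (hx : x ≍ y) :
    (initial.to (⟨X, x⟩ : Algebra F)).f ≍ (initial.to (⟨Y, y⟩ : Algebra G)).f := by
  subst h; subst hX; cases hx; rfl

theorem initAlg_congr {B : Type u₂} [Category.{v₂} B] {F G : B ⥤ B} [HasInitial (Algebra F)]
    [HasInitial (Algebra G)] (h : F = G) : (initAlg F).a = (initAlg G).a := by
  subst h; rfl

theorem sect_prod {A : Type u₁} [Category.{v₁} A] {A' : Type u₂} [Category.{v₂} A'] {B : Type u₃}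
    [Category.{v₃} B] (F : A' ⥤ A) (T : A × B ⥤ B) (a : A') :
    sect (F.prod (𝟭 B) ⋙ T) a = sect T (F.obj a) := by
  refine CategoryTheory.Functor.ext (fun _ => rfl) fun X Y f => ?_
  have h : T.map (F.map (𝟙 a) ×ₘ f) = T.map (𝟙 (F.obj a) ×ₘ f) := by rw [F.map_id]
  exact h.trans ((Category.id_comp _).trans (Category.comp_id _)).symm

theorem bimap_comp_heq {A : Type u₁} [Category.{v₁} A] {B : Type u₂} [Category.{v₂} B]
    (T : A × B ⥤ B) {a b : A} (f : a ⟶ b) {X Y : B} (h : X = Y) {x : T.obj (b, X) ⟶ X}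
    {y : T.obj (b, Y) ⟶ Y} (hx : x ≍ y) : bimap T f (𝟙 X) ≫ x ≍ bimap T f (𝟙 Y) ≫ y := by
  subst h; cases hx; rfl

theorem dagger_prod {A : Type u₁} [Category.{v₁} A] {A' : Type u₂} [Category.{v₂} A'] {B : Type u₃}
    [Category.{v₃} B] (F : A' ⥤ A) (T : A × B ⥤ B) [HasSectionAlgebras T]
    [HasSectionAlgebras (F.prod (𝟭 B) ⋙ T)] :
    dagger (F.prod (𝟭 B) ⋙ T) = F ⋙ dagger T := by
  have hobj : ∀ a, muObj (F.prod (𝟭 B) ⋙ T) a = muObj T (F.obj a) := fun a =>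
    initAlg_congr (sect_prod F T a)
  have hstr : ∀ a, muStr (F.prod (𝟭 B) ⋙ T) a ≍ muStr T (F.obj a) := fun a =>
    initAlg_str_heq (sect_prod F T a)
  refine Functor.hext hobj fun a b f => ?_
  refine initDesc_heq (sect_prod F T a) (hobj b) ?_
  exact bimap_comp_heq T (F.map f) (hobj b) (hstr b)

theorem consFunctor_pi {C : Type u₁} [Category.{v₁} C] {n m : ℕ} (F : Fin n → (Fin m → C) ⥤ C)
    (G : Fin (n + 1) → (Fin (m + 1) → C) ⥤ C) (h0 : G 0 = Pi.eval (fun _ => C) 0)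
    (hs : ∀ i : Fin n, consFunctor C m ⋙ G i.succ = CategoryTheory.Prod.fst _ _ ⋙ F i) :
    consFunctor C m ⋙ Functor.pi' G = (Functor.pi' F).prod (𝟭 C) ⋙ consFunctor C n := by
  refine Functor.pi_ext _ _ fun i => ?_
  refine Fin.cases ?_ (fun j => ?_) i
  · change consFunctor C m ⋙ G 0 = _
    rw [h0]; rfl
  · exact hs j

theorem dagger_pi (κ : AtomInterp 𝒜 C) {n m : ℕ} (F : Fin n → (Fin m → C) ⥤ C)
    (G : Fin (n + 1) → (Fin (m + 1) → C) ⥤ C) (h0 : G 0 = Pi.eval (fun _ => C) 0)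
    (hs : ∀ i : Fin n, consFunctor C m ⋙ G i.succ = CategoryTheory.Prod.fst _ _ ⋙ F i)
    (A : Ty 𝒜 (n + 1)) (A' : Ty 𝒜 (m + 1)) (h : A'.interp κ = Functor.pi' G ⋙ A.interp κ) :
    dagger (A'.bodyFunctor κ) = Functor.pi' F ⋙ dagger (A.bodyFunctor κ) := by
  have h1 : A'.bodyFunctor κ = (Functor.pi' F).prod (𝟭 C) ⋙ A.bodyFunctor κ := by
    change consFunctor C m ⋙ A'.interp κ = _
    rw [h, ← Functor.assoc, consFunctor_pi F G h0 hs, Functor.assoc]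
  have : HasSectionAlgebras ((Functor.pi' F).prod (𝟭 C) ⋙ A.bodyFunctor κ) := h1 ▸ inferInstance
  rw [← dagger_prod]
  exact dagger_congr h1

theorem Ty.interp_rename (κ : AtomInterp 𝒜 C) {n : ℕ} (A : Ty 𝒜 n) {m : ℕ} (ρ : Fin n → Fin m) :
    (A.rename ρ).interp κ = Functor.pi' (fun i => Pi.eval (fun _ => C) (ρ i)) ⋙ A.interp κ := by
  induction A generalizing m with
  | var i => rfl
  | unit => rfl
  | atom a => rfl
  | sum A B ihA ihB => rw [Ty.rename, interp_sum, ihA, ihB]; rfl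
  | tensor A B ihA ihB => rw [Ty.rename, interp_tensor, ihA, ihB]; rfl
  | mu A ih =>
    rw [Ty.rename, interp_mu, interp_mu]
    exact dagger_pi κ (fun i => Pi.eval (fun _ => C) (ρ i))
      (fun i => Pi.eval (fun _ => C) (Fin.cons (α := fun _ => Fin _) 0 (fun i => (ρ i).succ) i))
      rfl (fun i => rfl) A _ (ih _)

theorem Ty.interp_subst (κ : AtomInterp 𝒜 C) {n : ℕ} (A : Ty 𝒜 n) {m : ℕ} (σ : Fin n → Ty 𝒜 m) :
    (A.subst σ).interp κ = Functor.pi' (fun i => (σ i).interp κ) ⋙ A.interp κ := by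
  induction A generalizing m with
  | var i => rfl
  | unit => rfl
  | atom a => rfl
  | sum A B ihA ihB => rw [Ty.subst, interp_sum, ihA, ihB]; rfl
  | tensor A B ihA ihB => rw [Ty.subst, interp_tensor, ihA, ihB]; rfl
  | mu A ih =>
    rw [Ty.subst, interp_mu, interp_mu]
    exact dagger_pi κ (fun i => (σ i).interp κ)
      (fun i => (Fin.cons (α := fun _ => Ty 𝒜 _) (var 0) (fun i => (σ i).rename Fin.succ) i).interp κ)
      rfl (fun i => by rw [Fin.cons_succ, interp_rename]; rfl) A _ (ih _)


/-! #### The affine interpretation -/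

/-- Extension of a family of discarding maps by a `0`-th component. -/
def consDiscard {n : ℕ} {X : Fin n → C} {Z : C} (z : Z ⟶ 𝟙_ C) (d : ∀ i, X i ⟶ 𝟙_ C) :
    ∀ i, (consFunctor C n).obj (X, Z) i ⟶ 𝟙_ C :=
  Fin.cases (motive := fun i => (consFunctor C n).obj (X, Z) i ⟶ 𝟙_ C) z d

/-- The discarding maps of the affine interpretation: for objects `X i` with discarding maps `d i`,
the discarding map of `⟦Θ ⊢ A⟧ X`. At `μX.A` it is the unique algebra morphism into the object `I`
with its identity as discarding map; `Ty.affineInterpMu` shows that the affine interpretation of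
`μX.A` is then the parameterised initial algebra in the slice category. -/
noncomputable def Ty.discardMap (κ : AtomInterp 𝒜 C) : {n : ℕ} → (A : Ty 𝒜 n) → (X : Fin n → C) →
    (∀ i, X i ⟶ 𝟙_ C) → ((A.interp κ).obj X ⟶ 𝟙_ C)
  | _, .var i, _, d => d i
  | _, .unit, _, _ => 𝟙 (𝟙_ C)
  | _, .atom a, _, _ => κ.discard a
  | _, .sum A B, X, d => copair (A.discardMap κ X d) (B.discardMap κ X d)
  | _, .tensor A B, X, d => (A.discardMap κ X d ⊗ₘ B.discardMap κ X d) ≫ (λ_ (𝟙_ C)).hom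
  | n, .mu A, X, d => muDesc (A.bodyFunctor κ) X (𝟙_ C)
      (A.discardMap κ ((consFunctor C n).obj (X, 𝟙_ C)) (consDiscard (𝟙 (𝟙_ C)) d))

/-- The discarding map of `⟦Θ, X ⊢ A⟧ (X, Z)`. -/
noncomputable def Ty.bodyDiscard (κ : AtomInterp 𝒜 C) {n : ℕ} (A : Ty 𝒜 (n + 1)) {X : Fin n → C}
    (d : ∀ i, X i ⟶ 𝟙_ C) {Z : C} (z : Z ⟶ 𝟙_ C) : (A.bodyFunctor κ).obj (X, Z) ⟶ 𝟙_ C :=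
  A.discardMap κ ((consFunctor C n).obj (X, Z)) (consDiscard z d)

theorem Ty.discardMap_mu (κ : AtomInterp 𝒜 C) {n : ℕ} (A : Ty 𝒜 (n + 1)) (X : Fin n → C)
    (d : ∀ i, X i ⟶ 𝟙_ C) : (Ty.mu A).discardMap κ X d =
      muDesc (A.bodyFunctor κ) X (𝟙_ C) (A.bodyDiscard κ d (𝟙 _)) := rfl

theorem Ty.discardMap_natural (κ : AtomInterp 𝒜 C) {n : ℕ} (A : Ty 𝒜 n) {X Y : Fin n → C}
    (d : ∀ i, X i ⟶ 𝟙_ C) (e : ∀ i, Y i ⟶ 𝟙_ C) (f : X ⟶ Y) (hf : ∀ i, f i ≫ e i = d i) :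
    (A.interp κ).map f ≫ A.discardMap κ Y e = A.discardMap κ X d := by
  induction A with
  | var i => exact hf i
  | unit => exact Category.id_comp _
  | atom a => exact Category.id_comp _
  | sum A B ihA ihB =>
    have h : copair ((A.interp κ).map f ≫ ChosenCoproducts.left _ _)
        ((B.interp κ).map f ≫ ChosenCoproducts.right _ _) ≫
        copair (A.discardMap κ Y e) (B.discardMap κ Y e) =
        copair (A.discardMap κ X d) (B.discardMap κ X d) := by
      refine sum_hom_ext ?_ ?_
      · rw [left_copair_assoc, Category.assoc, left_copair, left_copair, ihA d e f hf]
      · rw [right_copair_assoc, Category.assoc, right_copair, right_copair, ihB d e f hf]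
    exact h
  | tensor A B ihA ihB =>
    have h : ((A.interp κ).map f ⊗ₘ (B.interp κ).map f) ≫
        (A.discardMap κ Y e ⊗ₘ B.discardMap κ Y e) ≫ (λ_ (𝟙_ C)).hom =
        (A.discardMap κ X d ⊗ₘ B.discardMap κ X d) ≫ (λ_ (𝟙_ C)).hom := by
      rw [← Category.assoc, MonoidalCategory.tensorHom_comp_tensorHom, ihA d e f hf, ihB d e f hf]
    exact h
  | @mu n A ih =>
    have h : muMap (A.bodyFunctor κ) f ≫
        muDesc (A.bodyFunctor κ) Y (𝟙_ C) (A.bodyDiscard κ e (𝟙 _)) =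
        muDesc (A.bodyFunctor κ) X (𝟙_ C) (A.bodyDiscard κ d (𝟙 _)) := by
      apply muDesc_unique
      have h2 : bimap (A.bodyFunctor κ) f (𝟙 (𝟙_ C)) ≫ A.bodyDiscard κ e (𝟙 _) =
          A.bodyDiscard κ d (𝟙 _) :=
        ih _ _ ((consFunctor C n).map (X := (X, 𝟙_ C)) (Y := (Y, 𝟙_ C)) (f ×ₘ 𝟙 (𝟙_ C)))
          (fun i => Fin.cases (Category.id_comp _) hf i)
      rw [← Category.assoc, muStr_muMap, Category.assoc, muStr_muDesc, bimap_comp_assoc, ← h2,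
        bimap_comp_assoc, Category.comp_id, Category.comp_id, Category.id_comp]
    exact h

theorem Ty.bimap_bodyDiscard (κ : AtomInterp 𝒜 C) {n : ℕ} (A : Ty 𝒜 (n + 1)) {X : Fin n → C}
    (d : ∀ i, X i ⟶ 𝟙_ C) {Z W : C} (k : Z ⟶ W) (w : W ⟶ 𝟙_ C) :
    bimap (A.bodyFunctor κ) (𝟙 X) k ≫ A.bodyDiscard κ d w = A.bodyDiscard κ d (k ≫ w) :=
  A.discardMap_natural κ _ _ ((consFunctor C n).map (X := (X, Z)) (Y := (X, W)) (𝟙 X ×ₘ k))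
    (fun i => Fin.cases rfl (fun _ => Category.id_comp _) i)

theorem Ty.muDesc_discard (κ : AtomInterp 𝒜 C) {n : ℕ} (A : Ty 𝒜 (n + 1)) {X : Fin n → C}
    (d : ∀ i, X i ⟶ 𝟙_ C) {W : C} (y : (A.bodyFunctor κ).obj (X, W) ⟶ W) (w : W ⟶ 𝟙_ C)
    (hy : y ≫ w = A.bodyDiscard κ d w) :
    muDesc (A.bodyFunctor κ) X W y ≫ w = (Ty.mu A).discardMap κ X d := by
  refine muDesc_unique (A.bodyFunctor κ) _ _ (A.bodyDiscard κ d (𝟙 _)) _ ?_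
  rw [← Category.assoc, muStr_muDesc, Category.assoc, hy, A.bimap_bodyDiscard, A.bimap_bodyDiscard,
    Category.comp_id]

/-- The affine interpretation `⟪Θ ⊢ A⟫ : C_aⁿ ⥤ C_a` of a type on the slice category
`C_a = C / I`. -/
noncomputable def Ty.affineInterp (κ : AtomInterp 𝒜 C) {n : ℕ} (A : Ty 𝒜 n) :
    (Fin n → Over (𝟙_ C)) ⥤ Over (𝟙_ C) where
  obj X := Over.mk (A.discardMap κ (fun i => (X i).left) fun i => (X i).hom)
  map f := Over.homMk ((A.interp κ).map fun i => (f i).left)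
    (A.discardMap_natural κ _ _ _ fun i => Over.w (f i))
  map_id X := by
    apply Over.OverMorphism.ext
    exact (A.interp κ).map_id _
  map_comp f g := by
    apply Over.OverMorphism.ext
    exact (A.interp κ).map_comp _ _

/-- The affine interpretation lies over the standard one. -/
theorem Ty.affineInterp_forget (κ : AtomInterp 𝒜 C) {n : ℕ} (A : Ty 𝒜 n) :
    A.affineInterp κ ⋙ Over.forget (𝟙_ C) =
      Functor.pi (fun _ => Over.forget (𝟙_ C)) ⋙ A.interp κ :=
  rfl

/-- The forgetful functor commutes with the extension of families by a `0`-th component. -/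
def forgetCons {n : ℕ} (X : Fin n → Over (𝟙_ C)) (Z : Over (𝟙_ C)) :
    (Functor.pi fun _ => Over.forget (𝟙_ C)).obj ((consFunctor (Over (𝟙_ C)) n).obj (X, Z)) ≅
      (consFunctor C n).obj ((fun i => (X i).left), Z.left) where
  hom := fun i => Fin.cases (motive := fun i =>
      ((consFunctor (Over (𝟙_ C)) n).obj (X, Z) i).left ⟶
        (consFunctor C n).obj ((fun i => (X i).left), Z.left) i)
    (𝟙 Z.left) (fun j => 𝟙 (X j).left) i
  inv := fun i => Fin.cases (motive := fun i =>
      (consFunctor C n).obj ((fun i => (X i).left), Z.left) i ⟶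
        ((consFunctor (Over (𝟙_ C)) n).obj (X, Z) i).left)
    (𝟙 Z.left) (fun j => 𝟙 (X j).left) i
  hom_inv_id := funext fun i => Fin.cases (Category.id_comp _) (fun _ => Category.id_comp _) i
  inv_hom_id := funext fun i => Fin.cases (Category.id_comp _) (fun _ => Category.id_comp _) i

/-- The underlying object of `⟪Θ, X ⊢ A⟫ (X, Z)` is `⟦Θ, X ⊢ A⟧` of the underlying objects. -/
noncomputable def Ty.bodyIso (κ : AtomInterp 𝒜 C) {n : ℕ} (A : Ty 𝒜 (n + 1))
    (X : Fin n → Over (𝟙_ C)) (Z : Over (𝟙_ C)) :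
    ((consFunctor (Over (𝟙_ C)) n ⋙ A.affineInterp κ).obj (X, Z)).left ≅
      (A.bodyFunctor κ).obj ((fun i => (X i).left), Z.left) :=
  (A.interp κ).mapIso (forgetCons X Z)

theorem Ty.bodyIso_discard (κ : AtomInterp 𝒜 C) {n : ℕ} (A : Ty 𝒜 (n + 1))
    (X : Fin n → Over (𝟙_ C)) (Z : Over (𝟙_ C)) :
    (A.bodyIso κ X Z).hom ≫ A.bodyDiscard κ (fun i => (X i).hom) Z.hom =
      ((consFunctor (Over (𝟙_ C)) n ⋙ A.affineInterp κ).obj (X, Z)).hom :=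
  A.discardMap_natural κ _ _ (forgetCons X Z).hom
    (fun i => Fin.cases (Category.id_comp _) (fun _ => Category.id_comp _) i)

theorem Ty.bodyIso_natural (κ : AtomInterp 𝒜 C) {n : ℕ} (A : Ty 𝒜 (n + 1))
    {X Y : Fin n → Over (𝟙_ C)} {Z W : Over (𝟙_ C)} (f : X ⟶ Y) (g : Z ⟶ W) :
    (bimap (consFunctor (Over (𝟙_ C)) n ⋙ A.affineInterp κ) f g).left ≫ (A.bodyIso κ Y W).hom =
      (A.bodyIso κ X Z).hom ≫
        bimap (A.bodyFunctor κ) (a := fun i => (X i).left) (a' := fun i => (Y i).left)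
          (fun i => (f i).left) g.left := by
  refine ((A.interp κ).map_comp _ _).symm.trans (Eq.trans ?_ ((A.interp κ).map_comp _ _))
  refine congrArg (A.interp κ).map (funext fun i => ?_)
  exact Fin.cases ((Category.comp_id _).trans (Category.id_comp _).symm)
    (fun _ => (Category.comp_id _).trans (Category.id_comp _).symm) i

theorem Ty.bodyIso_algebra_hom_iff (κ : AtomInterp 𝒜 C) {n : ℕ} (A : Ty 𝒜 (n + 1))
    (X : Fin n → Over (𝟙_ C)) {Z W : Over (𝟙_ C)}
    (z : (A.bodyFunctor κ).obj ((fun i => (X i).left), Z.left) ⟶ Z.left)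
    (w : (consFunctor (Over (𝟙_ C)) n ⋙ A.affineInterp κ).obj (X, W) ⟶ W) (f : Z ⟶ W) :
    (bimap (consFunctor (Over (𝟙_ C)) n ⋙ A.affineInterp κ) (𝟙 X) f).left ≫ w.left =
        ((A.bodyIso κ X Z).hom ≫ z) ≫ f.left ↔
      z ≫ f.left = bimap (A.bodyFunctor κ) (𝟙 fun i => (X i).left) f.left ≫
        (A.bodyIso κ X W).inv ≫ w.left := by
  have h1 : (bimap (consFunctor (Over (𝟙_ C)) n ⋙ A.affineInterp κ) (𝟙 X) f).left =
      (A.bodyIso κ X Z).hom ≫ bimap (A.bodyFunctor κ) (𝟙 fun i => (X i).left) f.left ≫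
        (A.bodyIso κ X W).inv := by
    have h2 := A.bodyIso_natural κ (𝟙 X) f
    rw [← Category.assoc, Iso.eq_comp_inv]
    exact h2
  rw [h1, Category.assoc, Category.assoc, Category.assoc, Iso.cancel_iso_hom_left]
  exact eq_comm

theorem Ty.bodyIso_inv_discard (κ : AtomInterp 𝒜 C) {n : ℕ} (A : Ty 𝒜 (n + 1))
    (X : Fin n → Over (𝟙_ C)) {W : Over (𝟙_ C)}
    (w : (consFunctor (Over (𝟙_ C)) n ⋙ A.affineInterp κ).obj (X, W) ⟶ W) :
    ((A.bodyIso κ X W).inv ≫ w.left) ≫ W.hom = A.bodyDiscard κ (fun i => (X i).hom) W.hom := by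
  rw [Category.assoc, Over.w w, Iso.inv_comp_eq]
  exact (A.bodyIso_discard κ X W).symm

/-- `⟪Θ ⊢ μX.A⟫` is a parameterised initial algebra of `⟪Θ, X ⊢ A⟫`. -/
noncomputable def Ty.affineInterpMu (κ : AtomInterp 𝒜 C) {n : ℕ} (A : Ty 𝒜 (n + 1)) :
    ParamInitialAlgebra (consFunctor (Over (𝟙_ C)) n ⋙ A.affineInterp κ) where
  functor := (Ty.mu A).affineInterp κ
  τ := NatIso.ofComponents
    (fun X => Over.isoMk (A.bodyIso κ X (((Ty.mu A).affineInterp κ).obj X) ≪≫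
        @asIso _ _ _ _ (muStr (A.bodyFunctor κ) fun i => (X i).left) (muStr_isIso _ _)) (by
      refine Eq.trans ?_ (A.bodyIso_discard κ X _)
      refine (Category.assoc _ _ _).trans (congrArg (_ ≫ ·) ?_)
      refine (muStr_muDesc (A.bodyFunctor κ) _ _ _).trans ?_
      exact (A.bimap_bodyDiscard κ _ _ _).trans (by rw [Category.comp_id]; rfl)))
    fun {X Y} f => by
      apply Over.OverMorphism.ext
      have h1 := A.bodyIso_natural κ f (((Ty.mu A).affineInterp κ).map f)
      have h2 := muStr_muMap (A.bodyFunctor κ) (a := fun i => (X i).left)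
        (b := fun i => (Y i).left) (fun i => (f i).left)
      refine (Category.assoc _ _ _).symm.trans ?_
      refine (congrArg (· ≫ muStr (A.bodyFunctor κ) fun i => (Y i).left) h1).trans ?_
      refine (Category.assoc _ _ _).trans ?_
      exact (congrArg (_ ≫ ·) h2.symm).trans (Category.assoc _ _ _).symm
  isInitial X := by
    refine IsInitial.ofUniqueHom (fun Y => ⟨Over.homMk (muDesc (A.bodyFunctor κ) _ Y.a.left
      ((A.bodyIso κ X Y.a).inv ≫ Y.str.left)) ?_, ?_⟩) ?_
    · exact A.muDesc_discard κ _ _ _ (A.bodyIso_inv_discard κ X Y.str)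
    · apply Over.OverMorphism.ext
      exact (A.bodyIso_algebra_hom_iff κ X (Z := ((Ty.mu A).affineInterp κ).obj X)
        (muStr (A.bodyFunctor κ) fun i => (X i).left) Y.str _).2 (muStr_muDesc _ _ _ _)
    · intro Y m
      apply Algebra.Hom.ext
      apply Over.OverMorphism.ext
      refine muDesc_unique (A.bodyFunctor κ) _ _ _ _ ?_
      exact (A.bodyIso_algebra_hom_iff κ X (Z := ((Ty.mu A).affineInterp κ).obj X)
        (muStr (A.bodyFunctor κ) fun i => (X i).left) Y.str m.f).1
          (congrArg CommaMorphism.left m.h)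

/-! #### Closed types -/

/-- The interpretation `⟦A⟧` of a closed type. -/
noncomputable def Ty.den (κ : AtomInterp 𝒜 C) (A : Ty 𝒜 0) : C :=
  (A.interp κ).obj fun i => i.elim0

/-- The discarding map `⟦A⟧ ⟶ I` of a closed type. -/
noncomputable def Ty.discard (κ : AtomInterp 𝒜 C) (A : Ty 𝒜 0) : A.den κ ⟶ 𝟙_ C :=
  A.discardMap κ (fun i => i.elim0) fun i => i.elim0

theorem Ty.den_unroll (κ : AtomInterp 𝒜 C) (A : Ty 𝒜 1) :
    A.unroll.den κ = (A.bodyFunctor κ).obj ((fun i => i.elim0), (Ty.mu A).den κ) := by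
  have h : A.unroll.den κ = (A.interp κ).obj fun i =>
      ((Fin.cons (α := fun _ => Ty 𝒜 0) (Ty.mu A) Ty.var i).interp κ).obj fun i => i.elim0 :=
    Functor.congr_obj (Ty.interp_subst κ A _) _
  rw [h]
  refine congrArg (A.interp κ).obj (funext fun i => ?_)
  exact Fin.cases rfl (fun j => j.elim0) i

/-- The isomorphism `fold : ⟦A[μX.A / X]⟧ ≅ ⟦μX.A⟧`, with inverse `unfold`: the structure map of the
initial algebra, along the equality `⟦A[μX.A / X]⟧ = ⟦X ⊢ A⟧ ⟦μX.A⟧`. -/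
noncomputable def Ty.foldIso (κ : AtomInterp 𝒜 C) (A : Ty 𝒜 1) :
    A.unroll.den κ ≅ (Ty.mu A).den κ :=
  eqToIso (A.den_unroll κ) ≪≫ @asIso _ _ _ _ (muStr (A.bodyFunctor κ) fun i => i.elim0) (muStr_isIso _ _)

end Interp

/-! ### Terms -/

section Terms

/-- Terms, over the atomic types `𝒜` and the term variables `Var`. -/
inductive Term (𝒜 : Type u₂) (Var : Type w) : Type (max u₂ w)
  /-- `new unit u` -/
  | newUnit (u : Var)
  /-- `discard x` -/
  | discard (x : Var)
  /-- `M; N` -/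
  | seq (M N : Term 𝒜 Var)
  /-- `skip` -/
  | skip
  /-- `while b do M` -/
  | whileDo (b : Var) (M : Term 𝒜 Var)
  /-- `y = left_{A,B} x` -/
  | left (A B : Ty 𝒜 0) (y x : Var)
  /-- `y = right_{A,B} x` -/
  | right (A B : Ty 𝒜 0) (y x : Var)
  /-- `case y of {left x₁ → M₁ | right x₂ → M₂}` -/
  | caseOf (y x₁ : Var) (M₁ : Term 𝒜 Var) (x₂ : Var) (M₂ : Term 𝒜 Var)
  /-- `x = (x₁, x₂)` -/
  | pair (x x₁ x₂ : Var)
  /-- `(x₁, x₂) = x` -/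
  | unpair (x₁ x₂ x : Var)
  /-- `y = fold_{μX.A} x` -/
  | fold (A : Ty 𝒜 1) (y x : Var)
  /-- `y = unfold x` -/
  | unfold (y x : Var)

/-- Variable contexts. The context `Γ, x : A` is the list `(x, A) :: Γ`. -/
abbrev Ctx (𝒜 : Type u₂) (Var : Type w) := List (Var × Ty 𝒜 0)

/-- The variables of a context. -/
def Ctx.vars {𝒜 : Type u₂} {Var : Type w} (Γ : Ctx 𝒜 Var) : List Var := Γ.map Prod.fst

/-- Witnesses that the context `Δ` is a rearrangement of the context `Γ`. -/
inductive Exchange {𝒜 : Type u₂} {Var : Type w} : Ctx 𝒜 Var → Ctx 𝒜 Var → Type (max u₂ w)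
  | refl (Γ : Ctx 𝒜 Var) : Exchange Γ Γ
  | swap (Γ : Ctx 𝒜 Var) (x y : Var) (A B : Ty 𝒜 0) :
      Exchange ((y, B) :: (x, A) :: Γ) ((x, A) :: (y, B) :: Γ)
  | cons {Γ Δ : Ctx 𝒜 Var} (x : Var) (A : Ty 𝒜 0) (e : Exchange Γ Δ) :
      Exchange ((x, A) :: Γ) ((x, A) :: Δ)
  | trans {Γ Δ Ξ : Ctx 𝒜 Var} (e : Exchange Γ Δ) (f : Exchange Δ Ξ) : Exchange Γ Ξ

/-- Derivations of the term judgement `⊢ ⟨Γ⟩ M ⟨Δ⟩`. The side conditions say that variables which are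
added to a context do not yet occur in it, so that, from a context with distinct variables, only
contexts with distinct variables arise. The rule `exchange` makes the order of the variables in a
context irrelevant. -/
inductive Typed {𝒜 : Type u₂} {Var : Type w} :
    Ctx 𝒜 Var → Term 𝒜 Var → Ctx 𝒜 Var → Type (max u₂ w)
  | newUnit (Γ : Ctx 𝒜 Var) (u : Var) (hu : u ∉ Γ.vars) :
      Typed Γ (.newUnit u) ((u, .unit) :: Γ)
  | discard (Γ : Ctx 𝒜 Var) (x : Var) (A : Ty 𝒜 0) :
      Typed ((x, A) :: Γ) (.discard x) Γ
  | skip (Γ : Ctx 𝒜 Var) : Typed Γ .skip Γ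
  | seq {Γ Γ' Δ : Ctx 𝒜 Var} {M N : Term 𝒜 Var} (t : Typed Γ M Γ') (s : Typed Γ' N Δ) :
      Typed Γ (.seq M N) Δ
  | whileDo {Γ : Ctx 𝒜 Var} {b : Var} {M : Term 𝒜 Var}
      (t : Typed ((b, Ty.bit) :: Γ) M ((b, Ty.bit) :: Γ)) :
      Typed ((b, Ty.bit) :: Γ) (.whileDo b M) ((b, Ty.bit) :: Γ)
  | left (Γ : Ctx 𝒜 Var) (y x : Var) (A B : Ty 𝒜 0) (hy : y ∉ Γ.vars) :
      Typed ((x, A) :: Γ) (.left A B y x) ((y, .sum A B) :: Γ)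
  | right (Γ : Ctx 𝒜 Var) (y x : Var) (A B : Ty 𝒜 0) (hy : y ∉ Γ.vars) :
      Typed ((x, B) :: Γ) (.right A B y x) ((y, .sum A B) :: Γ)
  | caseOf {Γ Δ : Ctx 𝒜 Var} (y : Var) {x₁ x₂ : Var} {A B : Ty 𝒜 0} {M₁ M₂ : Term 𝒜 Var}
      (h₁ : x₁ ∉ Γ.vars) (h₂ : x₂ ∉ Γ.vars)
      (t₁ : Typed ((x₁, A) :: Γ) M₁ Δ) (t₂ : Typed ((x₂, B) :: Γ) M₂ Δ) :
      Typed ((y, .sum A B) :: Γ) (.caseOf y x₁ M₁ x₂ M₂) Δ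
  | pair (Γ : Ctx 𝒜 Var) (x x₁ x₂ : Var) (A B : Ty 𝒜 0) (hx : x ∉ Γ.vars) :
      Typed ((x₂, B) :: (x₁, A) :: Γ) (.pair x x₁ x₂) ((x, .tensor A B) :: Γ)
  | unpair (Γ : Ctx 𝒜 Var) (x₁ x₂ x : Var) (A B : Ty 𝒜 0) (h₁ : x₁ ∉ Γ.vars) (h₂ : x₂ ∉ Γ.vars)
      (h₁₂ : x₁ ≠ x₂) :
      Typed ((x, .tensor A B) :: Γ) (.unpair x₁ x₂ x) ((x₂, B) :: (x₁, A) :: Γ)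
  | fold (Γ : Ctx 𝒜 Var) (y x : Var) (A : Ty 𝒜 1) (hy : y ∉ Γ.vars) :
      Typed ((x, A.unroll) :: Γ) (.fold A y x) ((y, .mu A) :: Γ)
  | unfold (Γ : Ctx 𝒜 Var) (y x : Var) (A : Ty 𝒜 1) (hy : y ∉ Γ.vars) :
      Typed ((x, .mu A) :: Γ) (.unfold y x) ((y, A.unroll) :: Γ)
  | exchange {Γ Γ' Δ Δ' : Ctx 𝒜 Var} {M : Term 𝒜 Var} (e : Exchange Γ Γ') (t : Typed Γ' M Δ')
      (f : Exchange Δ' Δ) : Typed Γ M Δ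

end Terms

/-! ### Operational semantics -/

section Operational

variable {𝒜 : Type u₂} {Var : Type w}

/-- Values. -/
inductive Val (𝒜 : Type u₂) : Type u₂
  | star
  | left (A B : Ty 𝒜 0) (v : Val 𝒜)
  | right (A B : Ty 𝒜 0) (v : Val 𝒜)
  | pair (v w : Val 𝒜)
  | fold (A : Ty 𝒜 1) (v : Val 𝒜)

/-- Value assignments: partial functions from term variables to values. -/
abbrev Store (𝒜 : Type u₂) (Var : Type w) := Var → Option (Val 𝒜)

/-- The empty value assignment. -/
def Store.empty : Store 𝒜 Var := fun _ => none

variable [DecidableEq Var]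

/-- The assignment `V` without `x`. -/
def Store.erase (V : Store 𝒜 Var) (x : Var) : Store 𝒜 Var := Function.update V x none

/-- The assignment `V, x = v`. -/
def Store.insert (V : Store 𝒜 Var) (x : Var) (v : Val 𝒜) : Store 𝒜 Var :=
  Function.update V x (some v)

/-- Program configurations `(M | V)`. -/
structure Config (𝒜 : Type u₂) (Var : Type w) where
  term : Term 𝒜 Var
  store : Store 𝒜 Var

/-- The term `if b then {M}`, that is,
`case b of {left u → b = left u | right u → b = right u; M}`. -/
def Term.ifThen (b u : Var) (M : Term 𝒜 Var) : Term 𝒜 Var :=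
  .caseOf b u (.left .unit .unit b u) u (.seq (.right .unit .unit b u) M)

/-- The small-step operational semantics. In the rule for loops, the bound variable `u` of
`if b then {M; while b do M}` is any variable which does not occur in the assignment. -/
inductive Step : Config 𝒜 Var → Config 𝒜 Var → Prop
  | newUnit (u : Var) (V : Store 𝒜 Var) :
      Step ⟨.newUnit u, V⟩ ⟨.skip, V.insert u .star⟩
  | discard (x : Var) (V : Store 𝒜 Var) (v : Val 𝒜) (hx : V x = some v) :
      Step ⟨.discard x, V⟩ ⟨.skip, V.erase x⟩
  | skipSeq (P : Term 𝒜 Var) (V : Store 𝒜 Var) :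
      Step ⟨.seq .skip P, V⟩ ⟨P, V⟩
  | seq {P P' : Term 𝒜 Var} {V V' : Store 𝒜 Var} (Q : Term 𝒜 Var) (h : Step ⟨P, V⟩ ⟨P', V'⟩) :
      Step ⟨.seq P Q, V⟩ ⟨.seq P' Q, V'⟩
  | whileDo (b u : Var) (M : Term 𝒜 Var) (V : Store 𝒜 Var) (v : Val 𝒜) (hb : V b = some v)
      (hu : V u = none) :
      Step ⟨.whileDo b M, V⟩ ⟨.ifThen b u (.seq M (.whileDo b M)), V⟩
  | left (A B : Ty 𝒜 0) (y x : Var) (V : Store 𝒜 Var) (v : Val 𝒜) (hx : V x = some v) :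
      Step ⟨.left A B y x, V⟩ ⟨.skip, (V.erase x).insert y (.left A B v)⟩
  | right (A B : Ty 𝒜 0) (y x : Var) (V : Store 𝒜 Var) (v : Val 𝒜) (hx : V x = some v) :
      Step ⟨.right A B y x, V⟩ ⟨.skip, (V.erase x).insert y (.right A B v)⟩
  | caseLeft (y x₁ x₂ : Var) (M₁ M₂ : Term 𝒜 Var) (V : Store 𝒜 Var) (A B : Ty 𝒜 0) (v : Val 𝒜)
      (hy : V y = some (.left A B v)) :
      Step ⟨.caseOf y x₁ M₁ x₂ M₂, V⟩ ⟨M₁, (V.erase y).insert x₁ v⟩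
  | caseRight (y x₁ x₂ : Var) (M₁ M₂ : Term 𝒜 Var) (V : Store 𝒜 Var) (A B : Ty 𝒜 0) (v : Val 𝒜)
      (hy : V y = some (.right A B v)) :
      Step ⟨.caseOf y x₁ M₁ x₂ M₂, V⟩ ⟨M₂, (V.erase y).insert x₂ v⟩
  | pair (x x₁ x₂ : Var) (V : Store 𝒜 Var) (v₁ v₂ : Val 𝒜) (h₁₂ : x₁ ≠ x₂)
      (h₁ : V x₁ = some v₁) (h₂ : V x₂ = some v₂) :
      Step ⟨.pair x x₁ x₂, V⟩ ⟨.skip, ((V.erase x₁).erase x₂).insert x (.pair v₁ v₂)⟩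
  | unpair (x₁ x₂ x : Var) (V : Store 𝒜 Var) (v₁ v₂ : Val 𝒜) (hx : V x = some (.pair v₁ v₂)) :
      Step ⟨.unpair x₁ x₂ x, V⟩ ⟨.skip, ((V.erase x).insert x₁ v₁).insert x₂ v₂⟩
  | fold (A : Ty 𝒜 1) (y x : Var) (V : Store 𝒜 Var) (v : Val 𝒜) (hx : V x = some v) :
      Step ⟨.fold A y x, V⟩ ⟨.skip, (V.erase x).insert y (.fold A v)⟩
  | unfold (y x : Var) (V : Store 𝒜 Var) (A : Ty 𝒜 1) (v : Val 𝒜) (hx : V x = some (.fold A v)) :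
      Step ⟨.unfold y x, V⟩ ⟨.skip, (V.erase x).insert y v⟩

/-- A configuration terminates if it reduces, in finitely many steps, to a terminal configuration
`(skip | V)`. -/
def Terminates (c : Config 𝒜 Var) : Prop :=
  ∃ V : Store 𝒜 Var, Relation.ReflTransGen Step c ⟨.skip, V⟩

end Operational

/-! ### Denotational semantics of terms -/

section Denotational

variable {𝒜 : Type u₂} {Var : Type w} {C : Type u₁} [Category.{v₁} C] [MonoidalCategory C]
  [SymmetricCategory C] [Model C]

open MonoidalCategory

/-- The least fixpoint `⋁ᵢ hⁱ(⊥)` of a Scott-continuous endofunction of a pointed dcpo. -/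
def leastFix {D : Type w} [CompletePartialOrder D] (h : D → D) : D := ⨆ i : ℕ, h^[i] ⊥

/-- The distributivity isomorphism `X ⊗ (Y + Z) ⟶ (X ⊗ Y) + (X ⊗ Z)`. -/
noncomputable def distrib (X Y Z : C) :
    X ⊗ ChosenCoproducts.sum Y Z ⟶ ChosenCoproducts.sum (X ⊗ Y) (X ⊗ Z) :=
  inv (distribMap X Y Z)

/-- The object `I + I`. -/
abbrev bitObj (C : Type u₁) [Category.{v₁} C] [MonoidalCategory C] [ChosenCoproducts C] : C :=
  ChosenCoproducts.sum (𝟙_ C) (𝟙_ C)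

/-- The endofunction `W_f(g) = [id ⊗ left, g ∘ f ∘ (id ⊗ right)] ∘ d`. -/
noncomputable def whileStep {X : C} (f : X ⊗ bitObj C ⟶ X ⊗ bitObj C)
    (g : X ⊗ bitObj C ⟶ X ⊗ bitObj C) : X ⊗ bitObj C ⟶ X ⊗ bitObj C :=
  distrib X (𝟙_ C) (𝟙_ C) ≫
    copair (X ◁ ChosenCoproducts.left (𝟙_ C) (𝟙_ C))
      (X ◁ ChosenCoproducts.right (𝟙_ C) (𝟙_ C) ≫ f ≫ g)

/-- The interpretation `⟦Γ⟧ = I ⊗ ⟦A₁⟧ ⊗ ⋯ ⊗ ⟦Aₙ⟧` of a context. -/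
noncomputable def Ctx.den (κ : AtomInterp 𝒜 C) : Ctx 𝒜 Var → C
  | [] => 𝟙_ C
  | (_, A) :: Γ => Ctx.den κ Γ ⊗ A.den κ

/-- The symmetry isomorphism of a rearrangement of contexts. -/
noncomputable def Exchange.den (κ : AtomInterp 𝒜 C) : {Γ Δ : Ctx 𝒜 Var} → Exchange Γ Δ →
    (Γ.den κ ⟶ Δ.den κ)
  | _, _, .refl Γ => 𝟙 (Γ.den κ)
  | _, _, .swap Γ _ _ A B =>
    (α_ (Γ.den κ) (A.den κ) (B.den κ)).hom ≫ Γ.den κ ◁ (β_ (A.den κ) (B.den κ)).hom ≫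
      (α_ (Γ.den κ) (B.den κ) (A.den κ)).inv
  | _, _, .cons _ A e => e.den κ ▷ A.den κ
  | _, _, .trans e f => e.den κ ≫ f.den κ

/-- The interpretation `⟦⊢ ⟨Γ⟩ M ⟨Δ⟩⟧ : ⟦Γ⟧ ⟶ ⟦Δ⟧` of a term judgement. -/
noncomputable def Typed.den (κ : AtomInterp 𝒜 C) : {Γ : Ctx 𝒜 Var} → {M : Term 𝒜 Var} →
    {Δ : Ctx 𝒜 Var} → Typed Γ M Δ → (Γ.den κ ⟶ Δ.den κ)
  | _, _, _, .newUnit Γ _ _ => (ρ_ (Γ.den κ)).inv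
  | _, _, _, .discard Γ _ A => Γ.den κ ◁ A.discard κ ≫ (ρ_ (Γ.den κ)).hom
  | _, _, _, .skip Γ => 𝟙 (Γ.den κ)
  | _, _, _, .seq t s => t.den κ ≫ s.den κ
  | _, _, _, .whileDo (Γ := Γ) t => leastFix (whileStep (X := Γ.den κ) (t.den κ))
  | _, _, _, .left Γ _ _ A B _ => Γ.den κ ◁ ChosenCoproducts.left (A.den κ) (B.den κ)
  | _, _, _, .right Γ _ _ A B _ => Γ.den κ ◁ ChosenCoproducts.right (A.den κ) (B.den κ)
  | _, _, _, .caseOf (Γ := Γ) (A := A) (B := B) _ _ _ t₁ t₂ =>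
    distrib (Γ.den κ) (A.den κ) (B.den κ) ≫ copair (t₁.den κ) (t₂.den κ)
  | _, _, _, .pair Γ _ _ _ A B _ => (α_ (Γ.den κ) (A.den κ) (B.den κ)).hom
  | _, _, _, .unpair Γ _ _ _ A B _ _ _ => (α_ (Γ.den κ) (A.den κ) (B.den κ)).inv
  | _, _, _, .fold Γ _ _ A _ => Γ.den κ ◁ (A.foldIso κ).hom
  | _, _, _, .unfold Γ _ _ A _ => Γ.den κ ◁ (A.foldIso κ).inv
  | _, _, _, .exchange e t f => e.den κ ≫ t.den κ ≫ f.den κ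

/-- A model is computationally adequate if `id_I ≠ ⊥`. -/
def ComputationallyAdequate (C : Type u₁) [Category.{v₁} C] [MonoidalCategory C]
    [SymmetricCategory C] [Model C] : Prop :=
  𝟙 (𝟙_ C) ≠ ⊥

end Denotational
end Lang

/-!
Terms are only ever run on value assignments that are built from syntactic values, so both
directions can be proved by following the execution of a term, without a logical relation on
recursive types.

A value `v : A` denotes a point `I ⟶ ⟦A⟧` (`ValDen`), and an assignment for `Γ` denotes a point
`I ⟶ ⟦Γ⟧` (`StoreDen`). Values are causal: their points are sections of the discarding maps
(`ValDen.comp_discard`). The only case which is not immediate is that of `fold`, which needs that the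
discarding map of `A[μX.A / X]` is that of `μX.A` along `fold` (`Ty.foldIso_hom_discard`). It rests on
the compatibility of discarding maps with substitution (`Ty.discardMap_subst`). Consequently the
denotation of an assignment is not `⊥` as soon as `id_I ≠ ⊥` (`StoreDen.ne_bot`).

Each small step preserves the composite of the point of the assignment with the denotation of the
term (`Step.sound`); for loops this is the fixpoint equation of `leastFix`. So if `(M | V)` terminates
at `V'`, this composite is the point of `V'` (`Typed.sound_of_terminates`) and is not `⊥`.

Conversely, a composite of the point of `V` with the denotation of `M` which is not `⊥` forces `M` to
terminate from `V`, by induction on the derivation of `M` (`Typed.terminates_of_ne_bot`). As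
composition is strict, the first part of `M; N` is not `⊥` either, so it terminates by induction, and
soundness gives the point on which the induction hypothesis for `N` applies. For a loop, composition
is Scott-continuous, so that some approximant `Wⁱ(⊥)` is not `⊥` on `V`, and induction on `i`
shows that the loop ends within `i` rounds (`Terminates.whileDo`).
-/

namespace Lang

open CategoryTheory CategoryTheory.Limits CategoryTheory.MonoidalCategory

universe w v₁ u₁ u₂

/-! ### Discarding maps and substitution -/

section Discard

theorem copair_heq {C : Type u₁} [Category.{v₁} C] [ChosenCoproducts C] {X Y X' Y' Z : C}
    (hX : X = X') (hY : Y = Y') {f : X ⟶ Z} {g : Y ⟶ Z} {f' : X' ⟶ Z} {g' : Y' ⟶ Z} (hf : f ≍ f')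
    (hg : g ≍ g') : copair f g ≍ copair f' g' := by
  subst hX hY; cases hf; cases hg; rfl

theorem tensorHom_comp_heq {C : Type u₁} [Category.{v₁} C] [MonoidalCategory C]
    {X Y X' Y' Z Z' W : C} (hX : X = X') (hY : Y = Y') {f : X ⟶ Z} {g : Y ⟶ Z'} {f' : X' ⟶ Z}
    {g' : Y' ⟶ Z'} (hf : f ≍ f') (hg : g ≍ g') (k : Z ⊗ Z' ⟶ W) :
    (f ⊗ₘ g) ≫ k ≍ (f' ⊗ₘ g') ≫ k := by
  subst hX hY; cases hf; cases hg; rfl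

variable {𝒜 : Type u₂} {C : Type u₁} [Category.{v₁} C] [MonoidalCategory C] [SymmetricCategory C]
  [Model C]

theorem Ty.discardMap_heq (κ : AtomInterp 𝒜 C) {n : ℕ} (A : Ty 𝒜 n) {X Y : Fin n → C}
    {d : ∀ i, X i ⟶ 𝟙_ C} {e : ∀ i, Y i ⟶ 𝟙_ C} (hX : ∀ i, X i = Y i) (hd : ∀ i, d i ≍ e i) :
    A.discardMap κ X d ≍ A.discardMap κ Y e := by
  obtain rfl : X = Y := funext hX
  obtain rfl : d = e := funext fun i => eq_of_heq (hd i)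
  rfl

/-- The induction step at `μX.A` of the compatibility of discarding maps with a substitution: `F` is
the substitution, `G` its extension under the binder, and `A'` the substituted type. -/
theorem Ty.discardMap_mu_heq (κ : AtomInterp 𝒜 C) {n m : ℕ} (F : Fin n → (Fin m → C) ⥤ C)
    (G : Fin (n + 1) → (Fin (m + 1) → C) ⥤ C) (h0 : G 0 = Pi.eval (fun _ => C) 0)
    (hs : ∀ i : Fin n, consFunctor C m ⋙ G i.succ = CategoryTheory.Prod.fst _ _ ⋙ F i)
    (A : Ty 𝒜 (n + 1)) (A' : Ty 𝒜 (m + 1)) (h : A'.interp κ = Functor.pi' G ⋙ A.interp κ)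
    (X : Fin m → C) (d : ∀ i, X i ⟶ 𝟙_ C) (e : ∀ i, (F i).obj X ⟶ 𝟙_ C)
    (hA : A'.bodyDiscard κ d (𝟙 (𝟙_ C)) ≍ A.bodyDiscard κ e (𝟙 (𝟙_ C))) :
    (Ty.mu A').discardMap κ X d ≍ (Ty.mu A).discardMap κ (fun i => (F i).obj X) e := by
  have h1 : A'.bodyFunctor κ = (Functor.pi' F).prod (𝟭 C) ⋙ A.bodyFunctor κ := by
    change consFunctor C m ⋙ A'.interp κ = _
    rw [h, ← Functor.assoc, consFunctor_pi F G h0 hs, Functor.assoc]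
  have h2 : sect (A'.bodyFunctor κ) X = sect (A.bodyFunctor κ) ((Functor.pi' F).obj X) := by
    rw [h1]
    exact sect_prod _ _ _
  exact initDesc_heq h2 rfl hA

theorem Ty.rename_obj (κ : AtomInterp 𝒜 C) {n : ℕ} (A : Ty 𝒜 n) {m : ℕ} (ρ : Fin n → Fin m)
    (X : Fin m → C) : ((A.rename ρ).interp κ).obj X = (A.interp κ).obj fun i => X (ρ i) :=
  Functor.congr_obj (A.interp_rename κ ρ) X

theorem Ty.subst_obj (κ : AtomInterp 𝒜 C) {n : ℕ} (A : Ty 𝒜 n) {m : ℕ} (σ : Fin n → Ty 𝒜 m)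
    (X : Fin m → C) :
    ((A.subst σ).interp κ).obj X = (A.interp κ).obj fun i => ((σ i).interp κ).obj X :=
  Functor.congr_obj (A.interp_subst κ σ) X

theorem Ty.discardMap_rename (κ : AtomInterp 𝒜 C) {n : ℕ} (A : Ty 𝒜 n) {m : ℕ}
    (ρ : Fin n → Fin m) (X : Fin m → C) (d : ∀ i, X i ⟶ 𝟙_ C) :
    (A.rename ρ).discardMap κ X d ≍ A.discardMap κ (fun i => X (ρ i)) fun i => d (ρ i) := by
  induction A generalizing m with
  | var i => rfl
  | unit => rfl
  | atom a => rfl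
  | sum A B ihA ihB =>
    exact copair_heq (A.rename_obj κ ρ X) (B.rename_obj κ ρ X) (ihA ρ X d) (ihB ρ X d)
  | tensor A B ihA ihB =>
    exact tensorHom_comp_heq (A.rename_obj κ ρ X) (B.rename_obj κ ρ X) (ihA ρ X d) (ihB ρ X d) _
  | mu A ih =>
    refine Ty.discardMap_mu_heq κ (fun i => Pi.eval (fun _ => C) (ρ i))
      (fun i => Pi.eval (fun _ => C) (Fin.cons (α := fun _ => Fin _) 0 (fun i => (ρ i).succ) i))
      rfl (fun i => rfl) A _ (A.interp_rename κ _) X d (fun i => d (ρ i)) ?_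
    refine (ih _ _ _).trans (A.discardMap_heq κ (fun i => ?_) fun i => ?_)
    · exact Fin.cases rfl (fun _ => rfl) i
    · exact Fin.cases HEq.rfl (fun _ => HEq.rfl) i

/-- Discarding maps commute with substitution. The equality is heterogeneous because
`⟦A[σ]⟧ X` and `⟦A⟧ (⟦σ⟧ X)` are equal objects, but not by definition. -/
theorem Ty.discardMap_subst (κ : AtomInterp 𝒜 C) {n : ℕ} (A : Ty 𝒜 n) {m : ℕ}
    (σ : Fin n → Ty 𝒜 m) (X : Fin m → C) (d : ∀ i, X i ⟶ 𝟙_ C) :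
    (A.subst σ).discardMap κ X d ≍
      A.discardMap κ (fun i => ((σ i).interp κ).obj X) fun i => (σ i).discardMap κ X d := by
  induction A generalizing m with
  | var i => rfl
  | unit => rfl
  | atom a => rfl
  | sum A B ihA ihB =>
    exact copair_heq (A.subst_obj κ σ X) (B.subst_obj κ σ X) (ihA σ X d) (ihB σ X d)
  | tensor A B ihA ihB =>
    exact tensorHom_comp_heq (A.subst_obj κ σ X) (B.subst_obj κ σ X) (ihA σ X d) (ihB σ X d) _
  | mu A ih =>
    refine Ty.discardMap_mu_heq κ (fun i => (σ i).interp κ)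
      (fun i => (Fin.cons (α := fun _ => Ty 𝒜 _) (var 0)
        (fun i => (σ i).rename Fin.succ) i).interp κ)
      rfl (fun i => by rw [Fin.cons_succ, interp_rename]; rfl) A _ (A.interp_subst κ _) X d
      (fun i => (σ i).discardMap κ X d) ?_
    refine (ih _ _ _).trans (A.discardMap_heq κ (fun i => ?_) fun i => ?_)
    · exact Fin.cases rfl (fun j => (σ j).rename_obj κ Fin.succ _) i
    · exact Fin.cases HEq.rfl (fun j => (σ j).discardMap_rename κ Fin.succ _ _) i

theorem Ty.discard_unroll (κ : AtomInterp 𝒜 C) (A : Ty 𝒜 1) :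
    A.unroll.discard κ ≍
      A.bodyDiscard κ (X := fun i => i.elim0) (fun i => i.elim0) ((Ty.mu A).discard κ) := by
  refine (A.discardMap_subst κ _ _ _).trans (A.discardMap_heq κ (fun i => ?_) fun i => ?_)
  · exact Fin.cases rfl (fun j => j.elim0) i
  · exact Fin.cases HEq.rfl (fun j => j.elim0) i

/-- Folding commutes with discarding. -/
theorem Ty.foldIso_hom_discard (κ : AtomInterp 𝒜 C) (A : Ty 𝒜 1) :
    (A.foldIso κ).hom ≫ (Ty.mu A).discard κ = A.unroll.discard κ := by
  have h1 : muStr (A.bodyFunctor κ) (fun i => i.elim0) ≫ (Ty.mu A).discard κ =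
      A.bodyDiscard κ (X := fun i => i.elim0) (fun i => i.elim0) ((Ty.mu A).discard κ) := by
    refine (muStr_muDesc _ _ _ _).trans ?_
    refine (A.bimap_bodyDiscard κ _ _ _).trans ?_
    rw [Category.comp_id]
    rfl
  refine (Category.assoc _ _ _).trans ((congrArg (eqToHom (A.den_unroll κ) ≫ ·) h1).trans ?_)
  exact eq_of_heq ((eqToHom_comp_heq _ _).trans (A.discard_unroll κ).symm)

end Discard

/-! ### Pairs of points -/

section PairPoint

variable {C : Type u₁} [Category.{v₁} C] [MonoidalCategory C]

/-- The point of `X ⊗ A` given by points of `X` and of `A`. -/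
def pairPoint {X A : C} (g : 𝟙_ C ⟶ X) (f : 𝟙_ C ⟶ A) : 𝟙_ C ⟶ X ⊗ A :=
  (ρ_ (𝟙_ C)).inv ≫ (g ⊗ₘ f)

theorem pairPoint_whiskerLeft {X A B : C} (g : 𝟙_ C ⟶ X) (f : 𝟙_ C ⟶ A) (k : A ⟶ B) :
    pairPoint g f ≫ X ◁ k = pairPoint g (f ≫ k) := by
  simp [pairPoint, MonoidalCategory.tensorHom_def]

theorem pairPoint_whiskerRight {X Y A : C} (g : 𝟙_ C ⟶ X) (f : 𝟙_ C ⟶ A) (h : X ⟶ Y) :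
    pairPoint g f ≫ h ▷ A = pairPoint (g ≫ h) f := by
  simp [pairPoint, MonoidalCategory.tensorHom_def']

theorem pairPoint_tensorHom {X Y A B : C} (g : 𝟙_ C ⟶ X) (f : 𝟙_ C ⟶ A) (h : X ⟶ Y) (k : A ⟶ B) :
    pairPoint g f ≫ (h ⊗ₘ k) = pairPoint (g ≫ h) (f ≫ k) := by
  simp [pairPoint]

theorem pairPoint_id {X : C} (g : 𝟙_ C ⟶ X) : pairPoint g (𝟙 (𝟙_ C)) = g ≫ (ρ_ X).inv := by
  simp [pairPoint]

theorem pairPoint_discard {X A : C} (g : 𝟙_ C ⟶ X) (f : 𝟙_ C ⟶ A) (d : A ⟶ 𝟙_ C)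
    (h : f ≫ d = 𝟙 (𝟙_ C)) : pairPoint g f ≫ X ◁ d ≫ (ρ_ X).hom = g := by
  rw [← Category.assoc, pairPoint_whiskerLeft, h, pairPoint_id, Category.assoc, Iso.inv_hom_id,
    Category.comp_id]

theorem pairPoint_associator {X A B : C} (g : 𝟙_ C ⟶ X) (f : 𝟙_ C ⟶ A) (k : 𝟙_ C ⟶ B) :
    pairPoint (pairPoint g f) k ≫ (α_ X A B).hom = pairPoint g (pairPoint f k) := by
  have h : (ρ_ (𝟙_ C)).inv ▷ 𝟙_ C ≫ (α_ (𝟙_ C) (𝟙_ C) (𝟙_ C)).hom =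
      𝟙_ C ◁ (ρ_ (𝟙_ C)).inv := by
    monoidal
  calc pairPoint (pairPoint g f) k ≫ (α_ X A B).hom
      = (ρ_ (𝟙_ C)).inv ≫ ((ρ_ (𝟙_ C)).inv ▷ 𝟙_ C ≫ (α_ (𝟙_ C) (𝟙_ C) (𝟙_ C)).hom) ≫
          (g ⊗ₘ (f ⊗ₘ k)) := by
        simp only [pairPoint, Category.assoc, ← associator_naturality, ← tensorHom_id,
          tensorHom_comp_tensorHom_assoc, Category.id_comp]
    _ = pairPoint g (pairPoint f k) := by
        rw [h]
        simp only [pairPoint, ← id_tensorHom, tensorHom_comp_tensorHom, Category.id_comp]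

theorem pairPoint_associator_inv {X A B : C} (g : 𝟙_ C ⟶ X) (f : 𝟙_ C ⟶ A) (k : 𝟙_ C ⟶ B) :
    pairPoint g (pairPoint f k) ≫ (α_ X A B).inv = pairPoint (pairPoint g f) k := by
  rw [← pairPoint_associator, Category.assoc, Iso.hom_inv_id, Category.comp_id]

theorem pairPoint_braiding [BraidedCategory C] {A B : C} (f : 𝟙_ C ⟶ A) (k : 𝟙_ C ⟶ B) :
    pairPoint f k ≫ (β_ A B).hom = pairPoint k f := by
  simp [pairPoint, unitors_inv_equal]

end PairPoint

/-! ### Least fixpoints and distributivity -/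

section Order

variable {C : Type u₁} [Category.{v₁} C]

theorem isLUB_leastFix {D : Type w} [CompletePartialOrder D] {h : D → D}
    (hh : Monotone h) : IsLUB (Set.range fun i : ℕ => h^[i] ⊥) (leastFix h) := by
  have : Monotone fun i : ℕ => h^[i] ⊥ := hh.monotone_iterate_of_le_map bot_le
  exact this.directed_le.directedOn_range.isLUB_sSup

theorem leastFix_eq {D : Type w} [CompletePartialOrder D] {h : D → D}
    (hh : ScottContinuous h) : h (leastFix h) = leastFix h := by
  have hL := isLUB_leastFix hh.monotone
  have hm : Monotone fun i : ℕ => h^[i] ⊥ := hh.monotone.monotone_iterate_of_le_map bot_le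
  have hL' := hh (Set.range_nonempty _) hm.directed_le.directedOn_range hL
  refine hL'.unique ⟨?_, fun b hb => hL.2 ?_⟩
  · rintro _ ⟨_, ⟨i, rfl⟩, rfl⟩
    exact hL.1 ⟨i + 1, Function.iterate_succ_apply' h i ⊥⟩
  · rintro _ ⟨i, rfl⟩
    exact (hm (Nat.le_succ i)).trans (hb ⟨_, ⟨i, rfl⟩, (Function.iterate_succ_apply' h i ⊥).symm⟩)

theorem comp_left_scott [DcpoEnriched C] {X Y Z : C} (f : X ⟶ Y) :
    ScottContinuous fun g : Y ⟶ Z => f ≫ g :=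
  (ScottContinuous.prodMk (.const f) .id).comp (DcpoEnriched.comp_scott X Y Z)

/-- Composition with a least fixpoint is `⊥` if it is `⊥` for all approximants. -/
theorem exists_comp_iterate_ne_bot [DcpoEnriched C] {X Y Z : C} (f : X ⟶ Y)
    {h : (Y ⟶ Z) → (Y ⟶ Z)} (hh : Monotone h) (hf : f ≫ leastFix h ≠ ⊥) :
    ∃ i : ℕ, f ≫ h^[i] ⊥ ≠ ⊥ := by
  by_contra! hi
  have hm : Monotone fun i : ℕ => h^[i] ⊥ := hh.monotone_iterate_of_le_map bot_le
  have hL := comp_left_scott f (Set.range_nonempty _) hm.directed_le.directedOn_range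
    (isLUB_leastFix hh)
  refine hf (le_bot_iff.1 (hL.2 ?_))
  rintro _ ⟨_, ⟨i, rfl⟩, rfl⟩
  exact (hi i).le

variable [MonoidalCategory C] [SymmetricCategory C] [Model C]

theorem whileStep_scott {X : C} (f : X ⊗ bitObj C ⟶ X ⊗ bitObj C) :
    ScottContinuous (whileStep f) := by
  refine .comp (.comp (.prodMk (.const _) ?_) (Model.copair_scott _ _ _)) (comp_left_scott _)
  exact (comp_left_scott f).comp (comp_left_scott _)

theorem whiskerLeft_left_distrib (X Y Z : C) :
    X ◁ ChosenCoproducts.left Y Z ≫ distrib X Y Z = ChosenCoproducts.left _ _ := by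
  rw [distrib, IsIso.comp_inv_eq, distribMap, left_copair]

theorem whiskerLeft_right_distrib (X Y Z : C) :
    X ◁ ChosenCoproducts.right Y Z ≫ distrib X Y Z = ChosenCoproducts.right _ _ := by
  rw [distrib, IsIso.comp_inv_eq, distribMap, right_copair]

theorem pairPoint_left_distrib {X Y Z W : C} (g : 𝟙_ C ⟶ X) (f : 𝟙_ C ⟶ Y) (p : X ⊗ Y ⟶ W)
    (q : X ⊗ Z ⟶ W) : pairPoint g (f ≫ ChosenCoproducts.left Y Z) ≫ distrib X Y Z ≫ copair p q =
      pairPoint g f ≫ p := by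
  rw [← pairPoint_whiskerLeft, Category.assoc, ← Category.assoc (X ◁ _), whiskerLeft_left_distrib,
    left_copair]

theorem pairPoint_right_distrib {X Y Z W : C} (g : 𝟙_ C ⟶ X) (f : 𝟙_ C ⟶ Z) (p : X ⊗ Y ⟶ W)
    (q : X ⊗ Z ⟶ W) : pairPoint g (f ≫ ChosenCoproducts.right Y Z) ≫ distrib X Y Z ≫ copair p q =
      pairPoint g f ≫ q := by
  rw [← pairPoint_whiskerLeft, Category.assoc, ← Category.assoc (X ◁ _), whiskerLeft_right_distrib,
    right_copair]

theorem pairPoint_right_whileStep {X : C} (g : 𝟙_ C ⟶ X) (f : 𝟙_ C ⟶ 𝟙_ C)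
    (h p : X ⊗ bitObj C ⟶ X ⊗ bitObj C) :
    pairPoint g (f ≫ ChosenCoproducts.right (𝟙_ C) (𝟙_ C)) ≫ whileStep h p =
      (pairPoint g (f ≫ ChosenCoproducts.right (𝟙_ C) (𝟙_ C)) ≫ h) ≫ p := by
  rw [whileStep, pairPoint_right_distrib, ← Category.assoc, pairPoint_whiskerLeft, Category.assoc]

end Order

/-! ### Denotations of values and of value assignments -/

section Stores

variable {𝒜 : Type u₂} {Var : Type w} {C : Type u₁} [Category.{v₁} C] [MonoidalCategory C]
  [SymmetricCategory C] [Model C]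

/-- `ValDen κ v A f` says that `v` is a value of type `A`, with denotation `f : I ⟶ ⟦A⟧`. -/
inductive ValDen (κ : AtomInterp 𝒜 C) : Val 𝒜 → (A : Ty 𝒜 0) → (𝟙_ C ⟶ A.den κ) → Prop
  | star : ValDen κ .star .unit (𝟙 (𝟙_ C))
  | left (A B : Ty 𝒜 0) {v : Val 𝒜} {f : 𝟙_ C ⟶ A.den κ} (h : ValDen κ v A f) :
      ValDen κ (.left A B v) (.sum A B) (f ≫ ChosenCoproducts.left (A.den κ) (B.den κ))
  | right (A B : Ty 𝒜 0) {v : Val 𝒜} {f : 𝟙_ C ⟶ B.den κ} (h : ValDen κ v B f) :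
      ValDen κ (.right A B v) (.sum A B) (f ≫ ChosenCoproducts.right (A.den κ) (B.den κ))
  | pair {A B : Ty 𝒜 0} {v w : Val 𝒜} {f : 𝟙_ C ⟶ A.den κ} {g : 𝟙_ C ⟶ B.den κ}
      (h : ValDen κ v A f) (k : ValDen κ w B g) :
      ValDen κ (.pair v w) (.tensor A B) (pairPoint f g)
  | fold (A : Ty 𝒜 1) {v : Val 𝒜} {f : 𝟙_ C ⟶ A.unroll.den κ} (h : ValDen κ v A.unroll f) :
      ValDen κ (.fold A v) (.mu A) (f ≫ (A.foldIso κ).hom)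

/-- Values are causal: discarding the denotation of a value is the identity. -/
theorem ValDen.comp_discard {κ : AtomInterp 𝒜 C} {v : Val 𝒜} {A : Ty 𝒜 0} {f : 𝟙_ C ⟶ A.den κ}
    (h : ValDen κ v A f) : f ≫ A.discard κ = 𝟙 (𝟙_ C) := by
  induction h with
  | star => exact Category.id_comp _
  | left A B _ ih =>
    exact (Category.assoc _ _ _).trans ((congrArg (_ ≫ ·) (left_copair _ _)).trans ih)
  | right A B _ ih =>
    exact (Category.assoc _ _ _).trans ((congrArg (_ ≫ ·) (right_copair _ _)).trans ih)
  | @pair A B v w f g _ _ ih₁ ih₂ =>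
    have h : pairPoint f g ≫ (A.discard κ ⊗ₘ B.discard κ) ≫ (λ_ (𝟙_ C)).hom = 𝟙 (𝟙_ C) := by
      rw [← Category.assoc, pairPoint_tensorHom, ih₁, ih₂, pairPoint_id, unitors_equal]
      simp
    exact h
  | fold A _ ih => rw [Category.assoc, Ty.foldIso_hom_discard, ih]

variable [DecidableEq Var]

/-- `StoreDen κ Γ V g` says that the value assignment `V` is defined exactly on the variables of
`Γ`, with values of the types declared there, and that `g : I ⟶ ⟦Γ⟧` is its denotation. -/
inductive StoreDen (κ : AtomInterp 𝒜 C) :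
    (Γ : Ctx 𝒜 Var) → Store 𝒜 Var → (𝟙_ C ⟶ Γ.den κ) → Prop
  | nil : StoreDen κ [] Store.empty (𝟙 (𝟙_ C))
  | cons {Γ : Ctx 𝒜 Var} {V : Store 𝒜 Var} {g : 𝟙_ C ⟶ Γ.den κ} (h : StoreDen κ Γ V g) {x : Var}
      {A : Ty 𝒜 0} {v : Val 𝒜} {f : 𝟙_ C ⟶ A.den κ} (hx : V x = none) (hv : ValDen κ v A f) :
      StoreDen κ ((x, A) :: Γ) (V.insert x v) (pairPoint g f)

theorem Store.insert_apply_self (V : Store 𝒜 Var) (x : Var) (v : Val 𝒜) :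
    V.insert x v x = some v :=
  Function.update_self ..

theorem Store.insert_apply_of_ne (V : Store 𝒜 Var) {x y : Var} (h : y ≠ x) (v : Val 𝒜) :
    V.insert x v y = V y :=
  Function.update_of_ne h ..

theorem Store.erase_insert {V : Store 𝒜 Var} {x : Var} (hx : V x = none) (v : Val 𝒜) :
    (V.insert x v).erase x = V := by
  rw [Store.erase, Store.insert, Function.update_idem, ← hx, Function.update_eq_self]

theorem Store.insert_comm (V : Store 𝒜 Var) {x y : Var} (h : x ≠ y) (v w : Val 𝒜) :
    (V.insert x v).insert y w = (V.insert y w).insert x v :=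
  Function.update_comm h _ _ _

theorem Store.ne_of_insert_eq_none {V : Store 𝒜 Var} {x y : Var} {v : Val 𝒜}
    (h : V.insert x v y = none) : y ≠ x := by
  rintro rfl
  simp [Store.insert] at h

variable {κ : AtomInterp 𝒜 C}

theorem StoreDen.exists_of_cons {Γ : Ctx 𝒜 Var} {x : Var} {A : Ty 𝒜 0} {W : Store 𝒜 Var}
    {k : 𝟙_ C ⟶ Ctx.den κ Γ ⊗ A.den κ} (h : StoreDen κ ((x, A) :: Γ) W k) :
    ∃ V v g f, StoreDen κ Γ V g ∧ V x = none ∧ ValDen κ v A f ∧ W = V.insert x v ∧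
      k = pairPoint g f := by
  cases h with
  | cons h hx hv => exact ⟨_, _, _, _, h, hx, hv, rfl, rfl⟩

/-- The freshness conditions of typing derivations and of value assignments agree. -/
theorem StoreDen.eq_none_iff {Γ : Ctx 𝒜 Var} {V : Store 𝒜 Var} {g : 𝟙_ C ⟶ Γ.den κ}
    (h : StoreDen κ Γ V g) (y : Var) : V y = none ↔ y ∉ Γ.vars := by
  induction h with
  | nil => simp [Store.empty, Ctx.vars]
  | @cons Γ V g _ x A v f hx hv ih =>
    by_cases hy : y = x
    · simp [hy, Store.insert, Ctx.vars]
    · rw [Store.insert_apply_of_ne V hy, ih]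
      simp [Ctx.vars, hy]

theorem StoreDen.exists_fresh [Infinite Var] {Γ : Ctx 𝒜 Var} {V : Store 𝒜 Var}
    {g : 𝟙_ C ⟶ Γ.den κ} (h : StoreDen κ Γ V g) : ∃ u, V u = none := by
  obtain ⟨u, hu⟩ := Infinite.exists_notMem_finset Γ.vars.toFinset
  exact ⟨u, (h.eq_none_iff u).2 fun hm => hu (List.mem_toFinset.2 hm)⟩

/-- The denotation of a value assignment has a retraction onto `I`. -/
theorem StoreDen.exists_retraction {Γ : Ctx 𝒜 Var} {V : Store 𝒜 Var} {g : 𝟙_ C ⟶ Γ.den κ}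
    (h : StoreDen κ Γ V g) : ∃ d : Γ.den κ ⟶ 𝟙_ C, g ≫ d = 𝟙 (𝟙_ C) := by
  induction h with
  | nil => exact ⟨𝟙 _, Category.id_comp _⟩
  | @cons Γ V g _ x A v f hx hv ih =>
    obtain ⟨d, hd⟩ := ih
    refine ⟨(Γ.den κ ◁ A.discard κ ≫ (ρ_ _).hom) ≫ d, ?_⟩
    exact (Category.assoc _ _ _).symm.trans
      ((congrArg (· ≫ d) (pairPoint_discard g f _ hv.comp_discard)).trans hd)

theorem StoreDen.ne_bot (hC : ComputationallyAdequate C) {Γ : Ctx 𝒜 Var} {V : Store 𝒜 Var}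
    {g : 𝟙_ C ⟶ Γ.den κ} (h : StoreDen κ Γ V g) : g ≠ ⊥ := by
  rintro rfl
  obtain ⟨d, hd⟩ := h.exists_retraction
  exact hC (hd.symm.trans (DcpoEnriched.bot_comp d))

/-- The structural isomorphism of a rearrangement preserves denotations of value assignments. -/
theorem StoreDen.exchange {Γ Δ : Ctx 𝒜 Var} (e : Exchange Γ Δ) {V : Store 𝒜 Var}
    {g : 𝟙_ C ⟶ Γ.den κ} (h : StoreDen κ Γ V g) : StoreDen κ Δ V (g ≫ e.den κ) := by
  induction e generalizing V with
  | refl Γ => exact (Category.comp_id g).symm ▸ h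
  | swap Γ x y A B =>
    obtain ⟨W, w, l, q, hW, hy, hw, rfl, rfl⟩ := h.exists_of_cons
    obtain ⟨V, v, k, p, hV, hx, hv, rfl, rfl⟩ := hW.exists_of_cons
    have hyx := Store.ne_of_insert_eq_none hy
    rw [Store.insert_comm V hyx.symm]
    have hg : pairPoint (pairPoint k p) q ≫ (α_ (Γ.den κ) (A.den κ) (B.den κ)).hom ≫
        Γ.den κ ◁ (β_ (A.den κ) (B.den κ)).hom ≫ (α_ (Γ.den κ) (B.den κ) (A.den κ)).inv =
        pairPoint (pairPoint k q) p := by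
      rw [← Category.assoc, pairPoint_associator, ← Category.assoc, pairPoint_whiskerLeft,
        pairPoint_braiding, pairPoint_associator_inv]
    refine cast (congrArg (StoreDen κ _ _) hg.symm) (.cons (.cons hV ?_ hw) ?_ hv)
    · rwa [Store.insert_apply_of_ne V hyx] at hy
    · rwa [Store.insert_apply_of_ne V hyx.symm]
  | cons x A e ih =>
    obtain ⟨V, v, k, p, hV, hx, hv, rfl, rfl⟩ := h.exists_of_cons
    exact cast (congrArg (StoreDen κ _ _) (pairPoint_whiskerRight _ _ _).symm) (.cons (ih hV) hx hv)
  | trans e f ihe ihf =>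
    exact cast (congrArg (StoreDen κ _ _) (Category.assoc _ _ _)) (ihf (ihe h))

end Stores

/-! ### Soundness -/

section Soundness

variable {𝒜 : Type u₂} {Var : Type w} {C : Type u₁} [Category.{v₁} C] [MonoidalCategory C]
  [SymmetricCategory C] [Model C] {κ : AtomInterp 𝒜 C}

theorem ValDen.sum_cases {A B : Ty 𝒜 0} {v : Val 𝒜} {f : 𝟙_ C ⟶ (Ty.sum A B).den κ}
    (h : ValDen κ v (.sum A B) f) :
    (∃ w k, ValDen κ w A k ∧ v = .left A B w ∧
      f = k ≫ ChosenCoproducts.left (A.den κ) (B.den κ)) ∨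
    ∃ w k, ValDen κ w B k ∧ v = .right A B w ∧
      f = k ≫ ChosenCoproducts.right (A.den κ) (B.den κ) := by
  cases h with
  | left _ _ h => exact .inl ⟨_, _, h, rfl, rfl⟩
  | right _ _ h => exact .inr ⟨_, _, h, rfl, rfl⟩

theorem ValDen.tensor_cases {A B : Ty 𝒜 0} {v : Val 𝒜} {f : 𝟙_ C ⟶ (Ty.tensor A B).den κ}
    (h : ValDen κ v (.tensor A B) f) :
    ∃ v₁ v₂ f₁ f₂, ValDen κ v₁ A f₁ ∧ ValDen κ v₂ B f₂ ∧ v = .pair v₁ v₂ ∧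
      f = pairPoint f₁ f₂ := by
  cases h with
  | pair h k => exact ⟨_, _, _, _, h, k, rfl, rfl⟩

theorem ValDen.mu_cases {A : Ty 𝒜 1} {v : Val 𝒜} {f : 𝟙_ C ⟶ (Ty.mu A).den κ}
    (h : ValDen κ v (.mu A) f) :
    ∃ w k, ValDen κ w A.unroll k ∧ v = .fold A w ∧ f = k ≫ (A.foldIso κ).hom := by
  cases h with
  | fold _ h => exact ⟨_, _, h, rfl, rfl⟩

variable [DecidableEq Var]

/-- The conclusion of `Step.sound` for a command which reduces to `skip` in one step: `g` is the
denotation of the final assignment, and `h` is the composite with the denotation of the command. -/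
theorem StoreDen.exists_skip {Γ : Ctx 𝒜 Var} {V : Store 𝒜 Var} {g h : 𝟙_ C ⟶ Γ.den κ}
    (hg : StoreDen κ Γ V g) (hh : g = h) :
    ∃ (Γ' : Ctx 𝒜 Var) (t' : Typed Γ' .skip Γ) (g' : 𝟙_ C ⟶ Γ'.den κ),
      StoreDen κ Γ' V g' ∧ g' ≫ t'.den κ = h :=
  ⟨Γ, .skip Γ, g, hg, (Category.comp_id g).trans hh⟩

/-- A derivation of a judgement for `skip` does nothing but rearrange the context. -/
theorem StoreDen.comp_skip {Γ Δ : Ctx 𝒜 Var} {M : Term 𝒜 Var} (t : Typed Γ M Δ) (hM : M = .skip)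
    {V : Store 𝒜 Var} {g : 𝟙_ C ⟶ Γ.den κ} (hV : StoreDen κ Γ V g) :
    StoreDen κ Δ V (g ≫ t.den κ) := by
  induction t with
  | skip Γ => exact (Category.comp_id g).symm ▸ hV
  | exchange e t f ih =>
    refine cast (congrArg (StoreDen κ _ _) ?_) ((ih hM (hV.exchange e)).exchange f)
    simp only [Category.assoc]
    rfl
  | _ => cases hM

/-- Small steps preserve types and denotations. -/
theorem Step.sound {Γ Δ : Ctx 𝒜 Var} {M : Term 𝒜 Var} (t : Typed Γ M Δ) {V : Store 𝒜 Var}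
    {g : 𝟙_ C ⟶ Γ.den κ} (hV : StoreDen κ Γ V g) {M' : Term 𝒜 Var} {V' : Store 𝒜 Var}
    (hs : Step ⟨M, V⟩ ⟨M', V'⟩) :
    ∃ (Γ' : Ctx 𝒜 Var) (t' : Typed Γ' M' Δ) (g' : 𝟙_ C ⟶ Γ'.den κ),
      StoreDen κ Γ' V' g' ∧ g' ≫ t'.den κ = g ≫ t.den κ := by
  induction t generalizing V M' V' with
  | newUnit Γ u hu =>
    cases hs
    exact (hV.cons ((hV.eq_none_iff u).2 hu) .star).exists_skip (pairPoint_id g)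
  | discard Γ x A =>
    obtain ⟨W, v, k, f, hW, hx, hv, rfl, rfl⟩ := hV.exists_of_cons
    cases hs
    rw [Store.erase_insert hx]
    exact hW.exists_skip (pairPoint_discard _ _ _ hv.comp_discard).symm
  | skip Γ => cases hs
  | seq t s iht ihs =>
    cases hs with
    | skipSeq =>
      exact ⟨_, s, _, hV.comp_skip t rfl, Category.assoc _ _ _⟩
    | seq _ hs =>
      obtain ⟨Γ', t', g', hV', hg'⟩ := iht hV hs
      refine ⟨Γ', t'.seq s, g', hV', ?_⟩
      exact (Category.assoc _ _ _).symm.trans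
        ((congrArg (· ≫ s.den κ) hg').trans (Category.assoc _ _ _))
  | @whileDo Γ b M t _ =>
    obtain ⟨W, v, k, f, hW, hb, hv, rfl, rfl⟩ := hV.exists_of_cons
    cases hs with
    | whileDo _ u _ _ _ _ hu =>
      have hb' := (hW.eq_none_iff b).1 hb
      have hu' := (hW.eq_none_iff u).1
        (Store.insert_apply_of_ne W (Store.ne_of_insert_eq_none hu) v ▸ hu)
      -- The unrolled loop denotes `W(⟦while b do M⟧)`, which the fixpoint equation identifies.
      refine ⟨_, .caseOf b hu' hu' (.left Γ b u .unit .unit hb')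
        (.seq (.right Γ b u .unit .unit hb') (.seq t (.whileDo t))), _, hV, ?_⟩
      exact congrArg (pairPoint k f ≫ ·) (leastFix_eq (whileStep_scott (X := Γ.den κ) (t.den κ)))
  | left Γ y x A B hy =>
    obtain ⟨W, v, k, f, hW, hx, hv, rfl, rfl⟩ := hV.exists_of_cons
    cases hs with
    | left _ _ _ _ _ v' hx' =>
      obtain rfl : v = v' := Option.some_injective _ ((W.insert_apply_self x v).symm.trans hx')
      rw [Store.erase_insert hx]
      exact (hW.cons ((hW.eq_none_iff y).2 hy) (hv.left A B)).exists_skip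
        (pairPoint_whiskerLeft _ _ _).symm
  | right Γ y x A B hy =>
    obtain ⟨W, v, k, f, hW, hx, hv, rfl, rfl⟩ := hV.exists_of_cons
    cases hs with
    | right _ _ _ _ _ v' hx' =>
      obtain rfl : v = v' := Option.some_injective _ ((W.insert_apply_self x v).symm.trans hx')
      rw [Store.erase_insert hx]
      exact (hW.cons ((hW.eq_none_iff y).2 hy) (hv.right A B)).exists_skip
        (pairPoint_whiskerLeft _ _ _).symm
  | @caseOf Γ Δ y x₁ x₂ A B M₁ M₂ h₁ h₂ t₁ t₂ ih₁ ih₂ =>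
    obtain ⟨W, v, k, f, hW, hy, hv, rfl, rfl⟩ := hV.exists_of_cons
    obtain ⟨v, f, hw, rfl, rfl⟩ | ⟨v, f, hw, rfl, rfl⟩ := hv.sum_cases
    · cases hs with
      | caseLeft _ _ _ _ _ _ _ _ v' hy' =>
        cases (W.insert_apply_self y _).symm.trans hy'
        rw [Store.erase_insert hy]
        exact ⟨_, t₁, _, hW.cons ((hW.eq_none_iff x₁).2 h₁) hw,
          (pairPoint_left_distrib _ _ _ _).symm⟩
      | caseRight _ _ _ _ _ _ _ _ v' hy' =>
        cases (W.insert_apply_self y _).symm.trans hy'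
    · cases hs with
      | caseLeft _ _ _ _ _ _ _ _ v' hy' =>
        cases (W.insert_apply_self y _).symm.trans hy'
      | caseRight _ _ _ _ _ _ _ _ v' hy' =>
        cases (W.insert_apply_self y _).symm.trans hy'
        rw [Store.erase_insert hy]
        exact ⟨_, t₂, _, hW.cons ((hW.eq_none_iff x₂).2 h₂) hw,
          (pairPoint_right_distrib _ _ _ _).symm⟩
  | pair Γ x x₁ x₂ A B hx =>
    obtain ⟨W', v₂, l, q, hW', hx₂, hv₂, rfl, rfl⟩ := hV.exists_of_cons
    obtain ⟨W, v₁, k, p, hW, hx₁, hv₁, rfl, rfl⟩ := hW'.exists_of_cons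
    cases hs with
    | pair _ _ _ _ w₁ w₂ h₁₂ h₁ h₂ =>
      cases (Store.insert_apply_self _ x₂ _).symm.trans h₂
      rw [Store.insert_apply_of_ne _ h₁₂] at h₁
      cases (Store.insert_apply_self _ x₁ _).symm.trans h₁
      have hx₂' := hx₂
      rw [Store.insert_apply_of_ne _ h₁₂.symm] at hx₂'
      have hx₁' : W.insert x₂ v₂ x₁ = none := by rwa [Store.insert_apply_of_ne _ h₁₂]
      rw [Store.insert_comm _ h₁₂, Store.erase_insert hx₁', Store.erase_insert hx₂']
      exact (hW.cons ((hW.eq_none_iff x).2 hx) (hv₁.pair hv₂)).exists_skip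
        (pairPoint_associator _ _ _).symm
  | unpair Γ x₁ x₂ x A B h₁ h₂ h₁₂ =>
    obtain ⟨W, v, k, f, hW, hx, hv, rfl, rfl⟩ := hV.exists_of_cons
    obtain ⟨v₁, v₂, f₁, f₂, hv₁, hv₂, rfl, rfl⟩ := hv.tensor_cases
    cases hs with
    | unpair _ _ _ _ w₁ w₂ hx' =>
      cases (W.insert_apply_self x _).symm.trans hx'
      rw [Store.erase_insert hx]
      have h₂' : W.insert x₁ v₁ x₂ = none := by
        rw [Store.insert_apply_of_ne _ h₁₂.symm]
        exact (hW.eq_none_iff x₂).2 h₂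
      exact ((hW.cons ((hW.eq_none_iff x₁).2 h₁) hv₁).cons h₂' hv₂).exists_skip
        (pairPoint_associator_inv _ _ _).symm
  | fold Γ y x A hy =>
    obtain ⟨W, v, k, f, hW, hx, hv, rfl, rfl⟩ := hV.exists_of_cons
    cases hs with
    | fold _ _ _ _ v' hx' =>
      obtain rfl : v = v' := Option.some_injective _ ((W.insert_apply_self x v).symm.trans hx')
      rw [Store.erase_insert hx]
      exact (hW.cons ((hW.eq_none_iff y).2 hy) (hv.fold A)).exists_skip
        (pairPoint_whiskerLeft _ _ _).symm
  | unfold Γ y x A hy =>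
    obtain ⟨W, v, k, f, hW, hx, hv, rfl, rfl⟩ := hV.exists_of_cons
    obtain ⟨v, f, hw, rfl, rfl⟩ := hv.mu_cases
    cases hs with
    | unfold _ _ _ _ v' hx' =>
      cases (W.insert_apply_self x _).symm.trans hx'
      rw [Store.erase_insert hx]
      refine (hW.cons ((hW.eq_none_iff y).2 hy) hw).exists_skip
        (Eq.symm ((pairPoint_whiskerLeft _ _ _).trans ?_))
      rw [Category.assoc, Iso.hom_inv_id, Category.comp_id]
  | exchange e t f ih =>
    obtain ⟨Γ', t', g', hV', hg'⟩ := ih (hV.exchange e) hs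
    refine ⟨Γ', .exchange (.refl _) t' f, g', hV', ?_⟩
    refine (congrArg (g' ≫ ·) (Category.id_comp _)).trans ((Category.assoc _ _ _).symm.trans ?_)
    exact (congrArg (· ≫ f.den κ) hg').trans (by simp only [Category.assoc]; rfl)

/-- If a program terminates, then its denotation maps the initial assignment to the final one. -/
theorem Typed.sound_of_terminates {c : Config 𝒜 Var} {V' : Store 𝒜 Var}
    (hs : Relation.ReflTransGen Step c ⟨.skip, V'⟩) {Γ Δ : Ctx 𝒜 Var} (t : Typed Γ c.term Δ)
    {g : 𝟙_ C ⟶ Γ.den κ} (hV : StoreDen κ Γ c.store g) : StoreDen κ Δ V' (g ≫ t.den κ) := by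
  induction hs using Relation.ReflTransGen.head_induction_on generalizing Γ with
  | refl => exact hV.comp_skip t rfl
  | head hstep _ ih =>
    obtain ⟨Γ', t', g', hV', hg'⟩ := hstep.sound t hV
    exact hg' ▸ ih t' hV'

end Soundness

/-! ### Adequacy -/

section Adequacy

variable {𝒜 : Type u₂} {Var : Type w} [DecidableEq Var]

theorem Step.seq_reflTransGen {c c' : Config 𝒜 Var} (h : Relation.ReflTransGen Step c c')
    (Q : Term 𝒜 Var) :
    Relation.ReflTransGen Step ⟨.seq c.term Q, c.store⟩ ⟨.seq c'.term Q, c'.store⟩ :=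
  Relation.ReflTransGen.lift (fun c : Config 𝒜 Var => (⟨.seq c.term Q, c.store⟩ : Config 𝒜 Var))
    (fun _ _ h => Step.seq Q h) c c' h

theorem Terminates.of_step {c c' : Config 𝒜 Var} (h : Step c c') (hc : Terminates c') :
    Terminates c :=
  hc.imp fun _ hs => hs.head h

theorem Terminates.seq {P Q : Term 𝒜 Var} {V V' : Store 𝒜 Var}
    (hP : Relation.ReflTransGen Step ⟨P, V⟩ ⟨.skip, V'⟩) (hQ : Terminates ⟨Q, V'⟩) :
    Terminates ⟨.seq P Q, V⟩ :=
  hQ.imp fun _ hs => (Step.seq_reflTransGen hP Q).trans (hs.head (.skipSeq Q V'))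

theorem Terminates.skip (V : Store 𝒜 Var) : Terminates (⟨.skip, V⟩ : Config 𝒜 Var) :=
  ⟨V, .refl⟩

variable {C : Type u₁} [Category.{v₁} C] [MonoidalCategory C] [SymmetricCategory C] [Model C]
  {κ : AtomInterp 𝒜 C}

theorem left_ne_bot_of_comp {X Y Z : C} {f : X ⟶ Y} {g : Y ⟶ Z} (h : f ≫ g ≠ ⊥) : f ≠ ⊥ := by
  rintro rfl
  exact h (DcpoEnriched.bot_comp g)

/-- A loop terminates if one of the approximants of its denotation is different from `⊥` on the
initial assignment, provided that its body has the property of adequacy. -/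
theorem Terminates.whileDo [Infinite Var] {Γ : Ctx 𝒜 Var} {b : Var} {M : Term 𝒜 Var}
    (t : Typed ((b, Ty.bit) :: Γ) M ((b, Ty.bit) :: Γ))
    (ht : ∀ {V : Store 𝒜 Var} {g : 𝟙_ C ⟶ Ctx.den κ ((b, Ty.bit) :: Γ)},
      StoreDen κ ((b, Ty.bit) :: Γ) V g → g ≫ t.den κ ≠ ⊥ → Terminates ⟨M, V⟩)
    (i : ℕ) {V : Store 𝒜 Var} {g : 𝟙_ C ⟶ Ctx.den κ ((b, Ty.bit) :: Γ)}
    (hV : StoreDen κ ((b, Ty.bit) :: Γ) V g)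
    (hg : g ≫ (whileStep (X := Γ.den κ) (t.den κ))^[i] ⊥ ≠ ⊥) : Terminates ⟨.whileDo b M, V⟩ := by
  induction i generalizing V g with
  | zero => exact absurd (DcpoEnriched.comp_bot g) hg
  | succ i ih =>
    obtain ⟨u, hu⟩ := hV.exists_fresh
    obtain ⟨W, v, k, f, hW, hb, hv, rfl, rfl⟩ := hV.exists_of_cons
    refine .of_step (.whileDo b u M _ v (W.insert_apply_self b v) hu) ?_
    obtain ⟨w, f, hw, rfl, rfl⟩ | ⟨w, f, hw, rfl, rfl⟩ := hv.sum_cases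
    · refine .of_step (.caseLeft _ _ _ _ _ _ _ _ _ (W.insert_apply_self b _)) ?_
      exact .of_step (.left _ _ _ _ _ _ (Store.insert_apply_self _ u w)) (.skip _)
    · refine .of_step (.caseRight _ _ _ _ _ _ _ _ _ (W.insert_apply_self b _)) ?_
      have hWu : W u = none := by
        rwa [Store.insert_apply_of_ne _ (Store.ne_of_insert_eq_none hu)] at hu
      rw [Store.erase_insert hb]
      refine .seq (.single (.right _ _ _ _ _ _ (Store.insert_apply_self W u w))) ?_
      rw [Store.erase_insert hWu]
      have hg' := fun h0 => hg (((congrArg (_ ≫ ·) (Function.iterate_succ_apply' _ i ⊥)).trans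
        (pairPoint_right_whileStep k f (t.den κ) _)).trans h0)
      obtain ⟨V', hV'⟩ := ht hV (left_ne_bot_of_comp hg')
      exact .seq hV' (ih (Typed.sound_of_terminates hV' t hV) hg')

/-- If the denotation of a term is different from `⊥` on a value assignment, then the term
terminates from this assignment. -/
theorem Typed.terminates_of_ne_bot [Infinite Var] {Γ Δ : Ctx 𝒜 Var} {M : Term 𝒜 Var}
    (t : Typed Γ M Δ) {V : Store 𝒜 Var} {g : 𝟙_ C ⟶ Γ.den κ} (hV : StoreDen κ Γ V g)
    (hg : g ≫ t.den κ ≠ ⊥) : Terminates ⟨M, V⟩ := by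
  induction t generalizing V with
  | newUnit Γ u hu => exact .of_step (.newUnit u V) (.skip _)
  | discard Γ x A =>
    obtain ⟨W, v, k, f, hW, hx, hv, rfl, rfl⟩ := hV.exists_of_cons
    exact .of_step (.discard x _ v (W.insert_apply_self x v)) (.skip _)
  | skip Γ => exact .skip V
  | seq t s iht ihs =>
    have hg' : (g ≫ t.den κ) ≫ s.den κ ≠ ⊥ := fun h0 => hg ((Category.assoc _ _ _).symm.trans h0)
    obtain ⟨V', hV'⟩ := iht hV (left_ne_bot_of_comp hg')
    exact .seq hV' (ihs (Typed.sound_of_terminates hV' t hV) hg')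
  | @whileDo Γ b M t ih =>
    obtain ⟨i, hi⟩ := exists_comp_iterate_ne_bot g
      (whileStep_scott (X := Γ.den κ) (t.den κ)).monotone hg
    exact .whileDo t ih i hV hi
  | left Γ y x A B hy =>
    obtain ⟨W, v, k, f, hW, hx, hv, rfl, rfl⟩ := hV.exists_of_cons
    exact .of_step (.left A B y x _ v (W.insert_apply_self x v)) (.skip _)
  | right Γ y x A B hy =>
    obtain ⟨W, v, k, f, hW, hx, hv, rfl, rfl⟩ := hV.exists_of_cons
    exact .of_step (.right A B y x _ v (W.insert_apply_self x v)) (.skip _)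
  | @caseOf Γ Δ y x₁ x₂ A B M₁ M₂ h₁ h₂ t₁ t₂ ih₁ ih₂ =>
    obtain ⟨W, v, k, f, hW, hy, hv, rfl, rfl⟩ := hV.exists_of_cons
    obtain ⟨v, f, hw, rfl, rfl⟩ | ⟨v, f, hw, rfl, rfl⟩ := hv.sum_cases
    · refine .of_step (.caseLeft y x₁ x₂ M₁ M₂ _ A B v (W.insert_apply_self y _)) ?_
      rw [Store.erase_insert hy]
      exact ih₁ (hW.cons ((hW.eq_none_iff x₁).2 h₁) hw)
        fun h0 => hg ((pairPoint_left_distrib _ _ _ _).trans h0)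
    · refine .of_step (.caseRight y x₁ x₂ M₁ M₂ _ A B v (W.insert_apply_self y _)) ?_
      rw [Store.erase_insert hy]
      exact ih₂ (hW.cons ((hW.eq_none_iff x₂).2 h₂) hw)
        fun h0 => hg ((pairPoint_right_distrib _ _ _ _).trans h0)
  | pair Γ x x₁ x₂ A B hx =>
    obtain ⟨W', v₂, l, q, hW', hx₂, hv₂, rfl, rfl⟩ := hV.exists_of_cons
    obtain ⟨W, v₁, k, p, hW, hx₁, hv₁, rfl, rfl⟩ := hW'.exists_of_cons
    have h₁₂ := (Store.ne_of_insert_eq_none hx₂).symm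
    refine .of_step (.pair x x₁ x₂ _ v₁ v₂ h₁₂ ?_ (Store.insert_apply_self _ x₂ v₂)) (.skip _)
    rw [Store.insert_apply_of_ne _ h₁₂, Store.insert_apply_self]
  | unpair Γ x₁ x₂ x A B h₁ h₂ h₁₂ =>
    obtain ⟨W, v, k, f, hW, hx, hv, rfl, rfl⟩ := hV.exists_of_cons
    obtain ⟨v₁, v₂, f₁, f₂, hv₁, hv₂, rfl, rfl⟩ := hv.tensor_cases
    exact .of_step (.unpair x₁ x₂ x _ v₁ v₂ (W.insert_apply_self x _)) (.skip _)
  | fold Γ y x A hy =>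
    obtain ⟨W, v, k, f, hW, hx, hv, rfl, rfl⟩ := hV.exists_of_cons
    exact .of_step (.fold A y x _ v (W.insert_apply_self x v)) (.skip _)
  | unfold Γ y x A hy =>
    obtain ⟨W, v, k, f, hW, hx, hv, rfl, rfl⟩ := hV.exists_of_cons
    obtain ⟨v, f, hw, rfl, rfl⟩ := hv.mu_cases
    exact .of_step (.unfold y x _ A v (W.insert_apply_self x _)) (.skip _)
  | exchange e t f ih =>
    exact ih (hV.exchange e) (left_ne_bot_of_comp (g := f.den κ) fun h0 => hg
      (Eq.trans (b := ((g ≫ e.den κ) ≫ t.den κ) ≫ f.den κ)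
        (by simp only [Category.assoc]; rfl) h0))

end Adequacy
end Lang

/-- Adequacy: in a computationally adequate model, the interpretation of a closed term is different
from `⊥` if and only if the term terminates from the empty value assignment. -/
theorem mainTheorem1 {𝒜 : Type*} {Var : Type*} [DecidableEq Var] [Infinite Var]
    {C : Type*} [CategoryTheory.Category C] [CategoryTheory.MonoidalCategory C]
    [CategoryTheory.SymmetricCategory C] [Lang.Model C] (κ : Lang.AtomInterp 𝒜 C)
    (hC : Lang.ComputationallyAdequate C)
    {M : Lang.Term 𝒜 Var} {Δ : Lang.Ctx 𝒜 Var} (t : Lang.Typed [] M Δ) :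
    t.den κ ≠ ⊥ ↔ Lang.Terminates ⟨M, Lang.Store.empty⟩ := by
  have hid : CategoryTheory.CategoryStruct.comp
      (CategoryTheory.CategoryStruct.id (CategoryTheory.MonoidalCategoryStruct.tensorUnit C))
      (t.den κ) = t.den κ := CategoryTheory.Category.id_comp _
  constructor
  · intro h
    exact t.terminates_of_ne_bot .nil fun h0 => h (hid.symm.trans h0)
  · rintro ⟨V, hV⟩ h0
    exact (Lang.Typed.sound_of_terminates hV t .nil).ne_bot hC (hid.trans h0)
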